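/- Conventions. $\mathbb R[[\lambda]]$ is ordered by declaring a nonzero series positive if its first nonvanishing coefficient is positive; $\mathbb C[[\lambda]]=\mathbb R[[\lambda]](\mathrm i)$ carries coefficientwise conjugation. All algebras are unital and associative. An element $a$ of a $^*$-algebra $\mathcal A$ over $\mathbb C[[\lambda]]$ is *positive* if $\omega(a)\ge 0$ for every $\mathbb C[[\lambda]]$-linear $\omega:\mathcal A\to\mathbb C[[\lambda]]$ with $\omega(b^*b)\ge0$ for all $b$. A *pre-Hilbert space* $\mathfrak H$ over $\mathbb C[[\lambda]]$ is a $\mathbb C[[\lambda]]$-module with a positive definite Hermitian $\mathbb C[[\lambda]]$-valued inner product, antilinear in the first argument; a *$^*$-representation* $\pi$ of $\mathcal A$ on it is an algebra homomorphism into its endomorphisms with $\langle\pi(a)\phi,\psi\rangle=\langle\phi,\pi(a^*)\psi\rangle$. For $^*$-algebras $\mathcal A,\mathcal B$ over $\mathbb C[[\lambda]]$, an *equivalence bimodule* is a $(\mathcal B$-$\mathcal A)$-bimodule $\mathcal E$ over $\mathbb C[[\lambda]]$ with an $\mathcal A$-valued, $\mathcal A$-right linear inner product $\langle\cdot,\cdot\rangle$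 (linear in the second argument) and a $\mathcal B$-valued, $\mathcal B$-left linear inner product $\Theta_{\cdot,\cdot}$ (linear in the first argument), such that: both are Hermitian, positive semi-definite ($\langle x,x\rangle$ and $\Theta_{x,x}$ are positive elements), and full (their values span $\mathcal A$, respectively $\mathcal B$); $\langle x,by\rangle=\langle b^*x,y\rangle$, $\Theta_{x,ya}=\Theta_{xa^*,y}$ and $\Theta_{x,y}z=x\langle y,z\rangle$; (P) for every $^*$-representation $(\mathfrak H,\pi)$ of $\mathcal A$ the inner product $\langle x\otimes\psi,y\otimes\phi\rangle=\langle\psi,\pi(\langle x,y\rangle)\phi\rangle$ on $\mathcal E\otimes_{\mathcal A}\mathfrak H$ is positive semi-definite; (Q) the analogue of (P) holds for $\mathcal B$, i.e. for every $^*$-representation $\pi$ of $\mathcal B$ from the right on $\mathfrak H$ the inner product $\langle\psi\otimes y,\phi\otimes x\rangle=\langle\psi,\phi\,\pi(\Theta_{x,y})\rangle$ on $\mathfrak H\otimes_{\mathcal B}\mathcal E$ is positive semi-definite. It is *non-degenerate* if both actions on $\mathcal E$ are non-degenerate. If an equivalence bimodule exists, $\mathcal B$ and $\mathcal A$ are *formally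 Morita equivalent*. Setting. Let $M$ be a smooth (finite-dimensional, Hausdorff, $\sigma$-compact) Poisson manifold without boundary, $C^\infty(M)$ its $^*$-algebra of complex-valued smooth functions, and $\star$ a Hermitian star product on $M$: an associative $\mathbb C[[\lambda]]$-bilinear product $f\star g=\sum_{r\ge0}C_r(f,g)\lambda^r$ on $C^\infty(M)[[\lambda]]$, with $C_r$ bilinear over $\mathbb C$, $C_0(f,g)=fg$, $C_1(f,g)-C_1(g,f)=\mathrm i\{f,g\}$, unit $1$, and $\overline{f\star g}=\overline g\star\overline f$. Put $\mathbf A=(C^\infty(M)[[\lambda]],\star)$. Let $(E,h_0)\to M$ be a smooth complex vector bundle of constant finite rank $k\ge1$ with a smooth Hermitian fiber metric. A *deformation* of $\Gamma^\infty(E)$ is a right $\mathbf A$-module $\mathbf E=(\Gamma^\infty(E)[[\lambda]],\bullet)$ with $s\bullet f=\sum_{r\ge0}R_r(s,f)\lambda^r$, $R_r$ bilinear over $\mathbb C$, $R_0(s,f)=sf$. A *Hermitian deformation* of $(\Gamma^\infty(E),h_0)$ is in addition equipped with $\mathbf h=\sum_{r\ge0}h_r\lambda^r$, where the $h_r$ for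 $r\geq 1$ are $\mathbb C$-sesquilinear maps $\Gamma^\infty(E)\times\Gamma^\infty(E)\to C^\infty(M)$ and $h_0$ is the given metric, such that $\mathbf h$ is a Hermitian, $\mathbf A$-right linear, positive definite $\mathbf A$-valued inner product ($\mathbf h(x,x)$ is a positive element of $\mathbf A$, and $\mathbf h(x,x)=0$ implies $x=0$). Theorem. Let $\mathbf E$ be any deformation of $\Gamma^\infty(E)$ corresponding to $\mathbf A$. Then there is an $\mathbf h$ making $\mathbf E$ a Hermitian deformation of $(\Gamma^\infty(E),h_0)$; and for every such $\mathbf h$, each element of $\operatorname{End}_{\mathbf A}(\mathbf E)$ has an adjoint with respect to $\mathbf h$, so that $\operatorname{End}_{\mathbf A}(\mathbf E)$ is a $^*$-algebra over $\mathbb C[[\lambda]]$, and $\mathbf E$, with the inner products $\mathbf h$ and $\Theta_{x,y}z=x\bullet\mathbf h(y,z)$, is a non-degenerate equivalence bimodule for $\operatorname{End}_{\mathbf A}(\mathbf E)$ and $\mathbf A$. Hence $\operatorname{End}_{\mathbf A}(\mathbf E)$ and $\mathbf A$ are formally Morita equivalent. -/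

import Mathlib

open scoped Manifold ContDiff TensorProduct PowerSeries
open MulOpposite

universe uEM uHM uM uF uE uH

noncomputable section

/-! ## The ordered ring `ℝ[[λ]]` and its quadratic extension `ℂ[[λ]]` -/

/-- Complex conjugation on `ℂ[[λ]] = ℝ[[λ]](i)`: conjugate every coefficient (`λ` is real). -/
instance formalScalarsStarRing : StarRing ℂ⟦X⟧ where
  star f := PowerSeries.map (starRingEnd ℂ) f
  star_involutive f := by ext n; simp
  star_mul f g := by rw [map_mul, mul_comm]
  star_add f g := map_add _ f g

theorem coeff_star_formal (f : ℂ⟦X⟧) (n : ℕ) :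
    PowerSeries.coeff n (star f) = starRingEnd ℂ (PowerSeries.coeff n f) :=
  PowerSeries.coeff_map _ _ _

/-- `z ≥ 0` in `ℂ[[λ]]`: `z` lies in `ℝ[[λ]]` and is zero or has a positive first nonvanishing
coefficient. -/
def FormalNonneg (z : ℂ⟦X⟧) : Prop :=
  (∀ n, (PowerSeries.coeff n z).im = 0) ∧
    (z = 0 ∨ ∃ n, 0 < (PowerSeries.coeff n z).re ∧ ∀ m < n, PowerSeries.coeff m z = 0)

/-! ## `*`-algebras over `ℂ[[λ]]` (unital rings with `ℂ[[λ]]`-antilinear involution), `*`-representations, equivalence bimodules -/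

section StarAlgebras

variable {A : Type*} [Ring A] [StarRing A] [Algebra ℂ⟦X⟧ A] [StarModule ℂ⟦X⟧ A]

/-- A positive linear functional on a `*`-algebra over `ℂ[[λ]]`. -/
def IsPositiveFunctional (u : A →ₗ[ℂ⟦X⟧] ℂ⟦X⟧) : Prop :=
  ∀ a : A, FormalNonneg (u (star a * a))

/-- A positive algebra element: every positive linear functional is nonnegative on it. -/
def IsPositiveElement (a : A) : Prop :=
  ∀ u : A →ₗ[ℂ⟦X⟧] ℂ⟦X⟧, IsPositiveFunctional u → FormalNonneg (u a)

end StarAlgebras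

/-- The structure of a pre-Hilbert space over `ℂ[[λ]]`; the inner product is antilinear in the
first argument, linear in the second, Hermitian and positive definite. -/
structure PreHilbert (H : Type*) [AddCommGroup H] [Module ℂ⟦X⟧ H] where
  inner : H →ₗ⋆[ℂ⟦X⟧] H →ₗ[ℂ⟦X⟧] ℂ⟦X⟧
  conj_symm : ∀ φ ψ, star (inner φ ψ) = inner ψ φ
  nonneg : ∀ φ, FormalNonneg (inner φ φ)
  definite : ∀ φ, inner φ φ = 0 → φ = 0

/-- A `*`-representation of the `*`-algebra `A` on a pre-Hilbert space over `ℂ[[λ]]`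
(not required to be unital). -/
structure StarRep (A : Type*) [Ring A] [StarRing A] [Algebra ℂ⟦X⟧ A] [StarModule ℂ⟦X⟧ A]
    {H : Type*} [AddCommGroup H] [Module ℂ⟦X⟧ H] (ip : PreHilbert H) where
  toHom : A →ₙₐ[ℂ⟦X⟧] Module.End ℂ⟦X⟧ H
  adjoint : ∀ (a : A) (φ ψ : H), ip.inner (toHom a φ) ψ = ip.inner φ (toHom (star a) ψ)

section Bimodules

universe wA wB wE wH

variable (A : Type wA) (B : Type wB) (E : Type wE) [Ring A] [StarRing A] [Algebra ℂ⟦X⟧ A]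
  [StarModule ℂ⟦X⟧ A] [Ring B] [StarRing B] [Algebra ℂ⟦X⟧ B] [StarModule ℂ⟦X⟧ B]
  [AddCommGroup E] [Module ℂ⟦X⟧ E] [Module Aᵐᵒᵖ E] [Module B E]

/-- The relations `x·a ⊗ ψ = x ⊗ ρ(a)ψ` cutting `E ⊗_A H` out of `E ⊗ H`. -/
def balancingRight {H : Type wH} [AddCommGroup H] [Module ℂ⟦X⟧ H] {ip : PreHilbert H}
    (ρ : StarRep A ip) : Submodule ℂ⟦X⟧ (E ⊗[ℂ⟦X⟧] H) :=
  Submodule.span ℂ⟦X⟧ {t | ∃ (x : E) (a : A) (ψ : H),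
    t = (op a • x) ⊗ₜ[ℂ⟦X⟧] ψ - x ⊗ₜ[ℂ⟦X⟧] (ρ.toHom a ψ)}

/-- The relations `φ·b ⊗ x = φ ⊗ b x` cutting `H ⊗_B E` out of `H ⊗ E`; a `*`-representation
of `B` from the right is a `*`-representation of the opposite algebra. -/
def balancingLeft {H : Type wH} [AddCommGroup H] [Module ℂ⟦X⟧ H] {ip : PreHilbert H}
    (ρ : StarRep Bᵐᵒᵖ ip) : Submodule ℂ⟦X⟧ (H ⊗[ℂ⟦X⟧] E) :=
  Submodule.span ℂ⟦X⟧ {t | ∃ (φ : H) (b : B) (x : E),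
    t = (ρ.toHom (op b) φ) ⊗ₜ[ℂ⟦X⟧] x - φ ⊗ₜ[ℂ⟦X⟧] (b • x)}

variable {A B E}

/-- Property (P): for every `*`-representation `(H, ρ)` of `A`, the inner product
`⟨x ⊗ ψ, y ⊗ φ⟩ = ⟨ψ, ρ(⟨x, y⟩) φ⟩` on `E ⊗_A H` (which it determines uniquely) exists and is
positive semi-definite. -/
def PropertyP (h : E → E → A) : Prop :=
  ∀ (H : Type wH) [AddCommGroup H] [Module ℂ⟦X⟧ H] (ip : PreHilbert H) (ρ : StarRep A ip),
    ∃ S : ((E ⊗[ℂ⟦X⟧] H) ⧸ balancingRight A E ρ) →ₗ⋆[ℂ⟦X⟧]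
        ((E ⊗[ℂ⟦X⟧] H) ⧸ balancingRight A E ρ) →ₗ[ℂ⟦X⟧] ℂ⟦X⟧,
      (∀ (x y : E) (ψ φ : H),
        S (Submodule.Quotient.mk (x ⊗ₜ[ℂ⟦X⟧] ψ)) (Submodule.Quotient.mk (y ⊗ₜ[ℂ⟦X⟧] φ)) =
          ip.inner ψ (ρ.toHom (h x y) φ)) ∧
      ∀ t, FormalNonneg (S t t)

/-- Property (Q): the analogue of (P) for `B`, expressed with `*`-representations of `B` from
the right (equivalently: (P) for the complex-conjugate bimodule). Here `Θ x y` is linear in `x`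
and antilinear in `y`. -/
def PropertyQ (Θ : E → E → B) : Prop :=
  ∀ (H : Type wH) [AddCommGroup H] [Module ℂ⟦X⟧ H] (ip : PreHilbert H) (ρ : StarRep Bᵐᵒᵖ ip),
    ∃ S : ((H ⊗[ℂ⟦X⟧] E) ⧸ balancingLeft B E ρ) →ₗ⋆[ℂ⟦X⟧]
        ((H ⊗[ℂ⟦X⟧] E) ⧸ balancingLeft B E ρ) →ₗ[ℂ⟦X⟧] ℂ⟦X⟧,
      (∀ (x y : E) (ψ φ : H),
        S (Submodule.Quotient.mk (ψ ⊗ₜ[ℂ⟦X⟧] y)) (Submodule.Quotient.mk (φ ⊗ₜ[ℂ⟦X⟧] x)) =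
          ip.inner ψ (ρ.toHom (op (Θ x y)) φ)) ∧
      ∀ t, FormalNonneg (S t t)

/-- A `(B-A)`-equivalence bimodule `E` between `*`-algebras over `ℂ[[λ]]`, with `A`-valued inner
product `h` and `B`-valued inner product `Θ`. -/
structure IsEquivalenceBimodule (h : E → E → A) (Θ : E → E → B) : Prop where
  -- bimodule over `ℂ[[λ]]`-algebras
  smul_smul_comm : ∀ (b : B) (a : A) (x : E), b • op a • x = op a • b • x
  smul_left : ∀ (z : ℂ⟦X⟧) (b : B) (x : E), (z • b) • x = z • b • x
  smul_right : ∀ (z : ℂ⟦X⟧) (a : A) (x : E), op (z • a) • x = z • op a • x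
  -- `h` is a full positive semi-definite `A`-right linear inner product
  h_add : ∀ x y y', h x (y + y') = h x y + h x y'
  h_smul : ∀ (z : ℂ⟦X⟧) (x y : E), h x (z • y) = z • h x y
  h_right : ∀ (x y : E) (a : A), h x (op a • y) = h x y * a
  h_star : ∀ x y, star (h x y) = h y x
  h_pos : ∀ x, IsPositiveElement (h x x)
  h_full : Submodule.span ℂ⟦X⟧ {a : A | ∃ x y, a = h x y} = ⊤
  -- `Θ` is a full positive semi-definite `B`-left linear inner product
  Θ_add : ∀ x x' y, Θ (x + x') y = Θ x y + Θ x' y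
  Θ_smul : ∀ (z : ℂ⟦X⟧) (x y : E), Θ (z • x) y = z • Θ x y
  Θ_left : ∀ (b : B) (x y : E), Θ (b • x) y = b * Θ x y
  Θ_star : ∀ x y, star (Θ x y) = Θ y x
  Θ_pos : ∀ x, IsPositiveElement (Θ x x)
  Θ_full : Submodule.span ℂ⟦X⟧ {b : B | ∃ x y, b = Θ x y} = ⊤
  -- compatibility
  h_adjoint : ∀ (b : B) (x y : E), h x (b • y) = h (star b • x) y
  Θ_adjoint : ∀ (a : A) (x y : E), Θ x (op a • y) = Θ (op (star a) • x) y
  compat : ∀ x y z : E, Θ x y • z = op (h y z) • x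
  -- properties (P) and (Q)
  propP : PropertyP.{wA, wE, wH} h
  propQ : PropertyQ.{wB, wE, wH} Θ

/-- A non-degenerate equivalence bimodule: both actions are in addition non-degenerate. -/
structure IsNondegenerateEquivalenceBimodule (h : E → E → A) (Θ : E → E → B) : Prop
    extends IsEquivalenceBimodule.{wA, wB, wE, wH} h Θ where
  left_nondegenerate : Submodule.span ℂ⟦X⟧ {x : E | ∃ (b : B) (y : E), x = b • y} = ⊤
  right_nondegenerate : Submodule.span ℂ⟦X⟧ {x : E | ∃ (a : A) (y : E), x = op a • y} = ⊤

variable (A B)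

/-- Formal Morita equivalence of the `*`-algebras `B` and `A` over `ℂ[[λ]]`: there is a
`(B-A)`-equivalence bimodule. -/
def FormallyMoritaEquivalent : Prop :=
  ∃ (E : Type wE) (_ : AddCommGroup E) (_ : Module ℂ⟦X⟧ E) (_ : Module Aᵐᵒᵖ E) (_ : Module B E)
    (h : E → E → A) (Θ : E → E → B), IsEquivalenceBimodule.{wA, wB, wE, wH} h Θ

end Bimodules

/-! ## Formal power series with coefficients in a vector space -/

/-- `V[[λ]]`: the series `∑ xₙ λⁿ` is the sequence `n ↦ xₙ`. -/
def FormalSeries (V : Type*) : Type _ := ℕ → V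

namespace FormalSeries

variable {U V W : Type*} [AddCommGroup U] [AddCommGroup V] [AddCommGroup W]

instance : AddCommGroup (FormalSeries V) := inferInstanceAs (AddCommGroup (ℕ → V))

theorem add_apply (x y : FormalSeries V) (n : ℕ) : (x + y) n = x n + y n := rfl

theorem zero_apply (n : ℕ) : (0 : FormalSeries V) n = 0 := rfl

/-- The constant series `v + 0 λ + 0 λ² + ⋯`. -/
def const (v : V) : FormalSeries V := fun n => if n = 0 then v else 0

variable [Module ℂ U] [Module ℂ V] [Module ℂ W]

/-- The Cauchy product `(∑ fₐ λᵃ) • (∑ x_b λᵇ) = ∑ fₐ x_b λᵃ⁺ᵇ`. -/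
instance : SMul ℂ⟦X⟧ (FormalSeries V) where
  smul f x := fun n => ∑ p ∈ Finset.HasAntidiagonal.antidiagonal n, PowerSeries.coeff p.1 f • x p.2

theorem smul_apply (f : ℂ⟦X⟧) (x : FormalSeries V) (n : ℕ) :
    (f • x) n = ∑ p ∈ Finset.HasAntidiagonal.antidiagonal n, PowerSeries.coeff p.1 f • x p.2 := rfl

instance : Module ℂ⟦X⟧ (FormalSeries V) where
  one_smul x := by
    funext n
    rw [smul_apply, Finset.sum_eq_single (0, n)]
    · simp
    · rintro ⟨a, b⟩ hp hne
      have ha : a ≠ 0 := by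
        rintro rfl
        simp only [Finset.HasAntidiagonal.mem_antidiagonal, zero_add] at hp
        exact hne (by rw [hp])
      simp [PowerSeries.coeff_one, ha]
    · simp
  mul_smul f g x := by
    funext n
    simp only [smul_apply, PowerSeries.coeff_mul, Finset.sum_smul, Finset.smul_sum, mul_smul]
    rw [Finset.sum_sigma', Finset.sum_sigma']
    refine Finset.sum_nbij' (fun s => ⟨(s.2.1, s.2.2 + s.1.2), (s.2.2, s.1.2)⟩)
      (fun s => ⟨(s.1.1 + s.2.1, s.2.2), (s.1.1, s.2.1)⟩) ?_ ?_ ?_ ?_ ?_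
    all_goals rintro ⟨⟨a, b⟩, ⟨c, d⟩⟩ hs
    all_goals simp only [Finset.mem_sigma, Finset.HasAntidiagonal.mem_antidiagonal, 
    and_true, true_and] at hs ⊢
    · omega
    · omega
    · obtain ⟨_, rfl⟩ := hs; rfl
    · obtain ⟨_, rfl⟩ := hs; rfl
  smul_zero f := by funext n; simp [smul_apply, zero_apply]
  smul_add f x y := by
    funext n; simp [smul_apply, add_apply, Finset.sum_add_distrib]
  add_smul f g x := by
    funext n; simp [smul_apply, add_apply, add_smul, Finset.sum_add_distrib]
  zero_smul x := by funext n; simp [smul_apply, zero_apply]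

/-- The `λ`-extension `(x, y) ↦ ∑ B_r(x_i, y_j) λ^(r+i+j)` of a sequence of biadditive maps `B_r`
to formal series. -/
def ext2 (B : ℕ → V → W → U) (x : FormalSeries V) (y : FormalSeries W) : FormalSeries U :=
  fun n => ∑ p ∈ Finset.HasAntidiagonal.antidiagonal n, ∑ q ∈ Finset.HasAntidiagonal.antidiagonal p.2, B p.1 (x q.1) (y q.2)

variable (B : ℕ → V →ₗ[ℂ] W →ₗ[ℂ] U)

theorem ext2_add_left (x x' : FormalSeries V) (y : FormalSeries W) :
    ext2 (fun r v w => B r v w) (x + x') y =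
      ext2 (fun r v w => B r v w) x y + ext2 (fun r v w => B r v w) x' y := by
  funext n
  simp [ext2, add_apply, Finset.sum_add_distrib]

theorem ext2_add_right (x : FormalSeries V) (y y' : FormalSeries W) :
    ext2 (fun r v w => B r v w) x (y + y') =
      ext2 (fun r v w => B r v w) x y + ext2 (fun r v w => B r v w) x y' := by
  funext n
  simp [ext2, add_apply, Finset.sum_add_distrib]

theorem ext2_zero_left (y : FormalSeries W) : ext2 (fun r v w => B r v w) 0 y = 0 := by
  funext n
  simp [ext2, zero_apply]

theorem ext2_zero_right (x : FormalSeries V) : ext2 (fun r v w => B r v w) x 0 = 0 := by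
  funext n
  simp [ext2, zero_apply]

theorem ext2_smul_left (f : ℂ⟦X⟧) (x : FormalSeries V) (y : FormalSeries W) :
    ext2 (fun r v w => B r v w) (f • x) y = f • ext2 (fun r v w => B r v w) x y := by
  funext n
  simp only [ext2, smul_apply, map_sum, map_smul, LinearMap.sum_apply, LinearMap.smul_apply,
    Finset.smul_sum]
  simp only [Finset.sum_sigma']
  refine Finset.sum_nbij'
    (fun s => ⟨(s.2.2.1, s.1.1 + (s.2.2.2 + s.2.1.2)),
      ⟨(s.1.1, s.2.2.2 + s.2.1.2), (s.2.2.2, s.2.1.2)⟩⟩)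
    (fun s => ⟨(s.2.1.1, s.1.1 + s.2.2.1 + s.2.2.2),
      ⟨(s.1.1 + s.2.2.1, s.2.2.2), (s.1.1, s.2.2.1)⟩⟩) ?_ ?_ ?_ ?_ ?_
  all_goals rintro ⟨⟨a, b⟩, ⟨c, d⟩, ⟨e, g⟩⟩ hs
  all_goals simp only [Finset.mem_sigma, Finset.HasAntidiagonal.mem_antidiagonal, 
    and_true, true_and] at hs ⊢
  · omega
  · omega
  · obtain ⟨h1, h2, h3⟩ := hs
    subst h1; subst h2; subst h3
    simp only [add_assoc, add_left_comm]
  · obtain ⟨h1, h2, h3⟩ := hs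
    subst h1; subst h2; subst h3
    simp only [add_assoc, add_left_comm]

theorem ext2_smul_right (f : ℂ⟦X⟧) (x : FormalSeries V) (y : FormalSeries W) :
    ext2 (fun r v w => B r v w) x (f • y) = f • ext2 (fun r v w => B r v w) x y := by
  funext n
  simp only [ext2, smul_apply, map_sum, map_smul, Finset.smul_sum]
  simp only [Finset.sum_sigma']
  refine Finset.sum_nbij'
    (fun s => ⟨(s.2.2.1, s.1.1 + (s.2.1.1 + s.2.2.2)),
      ⟨(s.1.1, s.2.1.1 + s.2.2.2), (s.2.1.1, s.2.2.2)⟩⟩)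
    (fun s => ⟨(s.2.1.1, s.2.2.1 + (s.1.1 + s.2.2.2)),
      ⟨(s.2.2.1, s.1.1 + s.2.2.2), (s.1.1, s.2.2.2)⟩⟩) ?_ ?_ ?_ ?_ ?_
  all_goals rintro ⟨⟨a, b⟩, ⟨c, d⟩, ⟨e, g⟩⟩ hs
  all_goals simp only [Finset.mem_sigma, Finset.HasAntidiagonal.mem_antidiagonal, 
    and_true, true_and] at hs ⊢
  · omega
  · omega
  · obtain ⟨h1, h2, h3⟩ := hs
    subst h1; subst h2; subst h3
    simp only [add_assoc, add_left_comm]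
  · obtain ⟨h1, h2, h3⟩ := hs
    subst h1; subst h2; subst h3
    simp only [add_assoc, add_left_comm]

/-- Coefficientwise involution on `A[[λ]]`. -/
def conj {A : Type*} [Star A] (x : FormalSeries A) : FormalSeries A := fun n => star (x n)

end FormalSeries

/-! ## Hermitian formal deformations of a unital `*`-algebra over `ℂ` -/

section Deformations

universe u v

/-- A Hermitian formal deformation of the unital `*`-algebra `A`: an associative
`ℂ[[λ]]`-bilinear product `a ⋆ b = ∑ C_r(a, b) λ^r` on `A[[λ]]` with `C_0` the product of `A`,
with unit the unit of `A`, and for which the involution of `A` is still an involution. -/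
structure HermitianDeformation (A : Type u) [Ring A] [Algebra ℂ A] [StarRing A] where
  C : ℕ → A →ₗ[ℂ] A →ₗ[ℂ] A
  C_zero : ∀ a b, C 0 a b = a * b
  assoc : ∀ a b c : FormalSeries A,
    FormalSeries.ext2 (fun r v w => C r v w) (FormalSeries.ext2 (fun r v w => C r v w) a b) c =
      FormalSeries.ext2 (fun r v w => C r v w) a (FormalSeries.ext2 (fun r v w => C r v w) b c)
  one_star : ∀ a : FormalSeries A,
    FormalSeries.ext2 (fun r v w => C r v w) (FormalSeries.const 1) a = a
  star_one : ∀ a : FormalSeries A,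
    FormalSeries.ext2 (fun r v w => C r v w) a (FormalSeries.const 1) = a
  hermitian : ∀ a b : FormalSeries A,
    FormalSeries.conj (FormalSeries.ext2 (fun r v w => C r v w) a b) =
      FormalSeries.ext2 (fun r v w => C r v w) (FormalSeries.conj b) (FormalSeries.conj a)

variable {A : Type u} [Ring A] [Algebra ℂ A] [StarRing A]

/-- The deformed algebra `𝐀 = (A[[λ]], ⋆)`. -/
def HermitianDeformation.Alg (_ : HermitianDeformation A) : Type u := FormalSeries A

namespace HermitianDeformation

variable (D : HermitianDeformation A)

instance : AddCommGroup D.Alg := inferInstanceAs (AddCommGroup (FormalSeries A))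

instance : Module ℂ⟦X⟧ D.Alg := inferInstanceAs (Module ℂ⟦X⟧ (FormalSeries A))

instance : Mul D.Alg := ⟨FormalSeries.ext2 (fun r v w => D.C r v w)⟩

instance : One D.Alg := ⟨FormalSeries.const (1 : A)⟩

instance : Ring D.Alg :=
  { (inferInstance : AddCommGroup D.Alg), (inferInstance : Mul D.Alg),
    (inferInstance : One D.Alg) with
    left_distrib := FormalSeries.ext2_add_right D.C
    right_distrib := FormalSeries.ext2_add_left D.C
    zero_mul := FormalSeries.ext2_zero_left D.C
    mul_zero := FormalSeries.ext2_zero_right D.C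
    mul_assoc := D.assoc
    one_mul := D.one_star
    mul_one := D.star_one }

instance : Algebra ℂ⟦X⟧ D.Alg :=
  Algebra.ofModule (FormalSeries.ext2_smul_left D.C) (FormalSeries.ext2_smul_right D.C)

instance : StarRing D.Alg where
  star := FormalSeries.conj (A := A)
  star_involutive a := funext fun n => star_star (a n)
  star_mul := D.hermitian
  star_add a b := funext fun n => star_add (a n) (b n)

instance [StarModule ℂ A] : StarModule ℂ⟦X⟧ D.Alg where
  star_smul z a := funext fun n => by
    change star (∑ p ∈ Finset.HasAntidiagonal.antidiagonal n,
      PowerSeries.coeff p.1 z • (show FormalSeries A from a) p.2) =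
      ∑ p ∈ Finset.HasAntidiagonal.antidiagonal n,
        PowerSeries.coeff p.1 (star z) • star ((show FormalSeries A from a) p.2)
    rw [star_sum]
    exact Finset.sum_congr rfl fun p _ => by rw [star_smul, coeff_star_formal]; rfl

end HermitianDeformation

/-! ## Deformations of right modules and of inner products -/

variable {E : Type v} [AddCommGroup E] [Module ℂ E] [Module Aᵐᵒᵖ E]

/-- A deformation of the right `A`-module `E` corresponding to `𝐀`: a right `𝐀`-module structure
`x • a = ∑ R_r(x, a) λ^r` on `E[[λ]]` with `R_0` the given action. -/
structure ModuleDeformation (D : HermitianDeformation A) (E : Type v) [AddCommGroup E]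
    [Module ℂ E] [Module Aᵐᵒᵖ E] where
  R : ℕ → E →ₗ[ℂ] A →ₗ[ℂ] E
  R_zero : ∀ x a, R 0 x a = op a • x
  assoc : ∀ (x : FormalSeries E) (a b : D.Alg),
    FormalSeries.ext2 (fun r v w => R r v w) (FormalSeries.ext2 (fun r v w => R r v w) x a) b =
      FormalSeries.ext2 (fun r v w => R r v w) x (a * b : D.Alg)
  act_one : ∀ x : FormalSeries E,
    FormalSeries.ext2 (fun r v w => R r v w) x (1 : D.Alg) = x

variable {D : HermitianDeformation A}

/-- The deformed module `𝐄 = (E[[λ]], •)`. -/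
def ModuleDeformation.Mod (_ : ModuleDeformation D E) : Type v := FormalSeries E

namespace ModuleDeformation

variable (𝓔 : ModuleDeformation D E)

instance : AddCommGroup 𝓔.Mod := inferInstanceAs (AddCommGroup (FormalSeries E))

instance : Module ℂ⟦X⟧ 𝓔.Mod := inferInstanceAs (Module ℂ⟦X⟧ (FormalSeries E))

instance : Module D.Algᵐᵒᵖ 𝓔.Mod where
  smul a x := FormalSeries.ext2 (fun r v w => 𝓔.R r v w) x a.unop
  one_smul := 𝓔.act_one
  mul_smul a b x := (𝓔.assoc x b.unop a.unop).symm
  smul_zero a := FormalSeries.ext2_zero_left 𝓔.R a.unop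
  smul_add a x y := FormalSeries.ext2_add_left 𝓔.R x y a.unop
  add_smul a b x := FormalSeries.ext2_add_right 𝓔.R x a.unop b.unop
  zero_smul x := FormalSeries.ext2_zero_right 𝓔.R x

instance : SMulCommClass D.Algᵐᵒᵖ ℂ⟦X⟧ 𝓔.Mod where
  smul_comm a z x := FormalSeries.ext2_smul_left 𝓔.R z x a.unop

instance : IsScalarTower ℂ⟦X⟧ D.Algᵐᵒᵖ 𝓔.Mod where
  smul_assoc z a x := FormalSeries.ext2_smul_right 𝓔.R z x a.unop

end ModuleDeformation

/-- The `λ`-extension `𝐡 = ∑ h_r λ^r : 𝐄 × 𝐄 → 𝐀` of maps `h_r : E × E → A`. -/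
def deformedForm [StarModule ℂ A] (𝓔 : ModuleDeformation D E) (h : ℕ → E →ₗ⋆[ℂ] E →ₗ[ℂ] A) :
    𝓔.Mod → 𝓔.Mod → D.Alg :=
  FormalSeries.ext2 (fun r v w => h r v w)

/-- A choice of `𝐡 = ∑ h_r λ^r` that turns the deformed module `𝐄` into a Hermitian deformation of
`(E, h₀)`: a positive definite, `𝐀`-valued, `𝐀`-right linear inner product on `E[[λ]]` with
zeroth order `h₀`. The `h_r` are antilinear in the first and linear in the second argument. -/
structure HermitianModuleDeformation [StarModule ℂ A] (𝓔 : ModuleDeformation D E)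
    (h₀ : E →ₗ⋆[ℂ] E →ₗ[ℂ] A) where
  coeff : ℕ → E →ₗ⋆[ℂ] E →ₗ[ℂ] A
  coeff_zero : coeff 0 = h₀
  conj_symm : ∀ x y, star (deformedForm 𝓔 coeff x y) = deformedForm 𝓔 coeff y x
  right_linear : ∀ x y (a : D.Alg),
    deformedForm 𝓔 coeff x (op a • y) = deformedForm 𝓔 coeff x y * a
  nonneg : ∀ x, IsPositiveElement (deformedForm 𝓔 coeff x x)
  definite : ∀ x, deformedForm 𝓔 coeff x x = 0 → x = 0

namespace HermitianModuleDeformation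

variable [StarModule ℂ A] {𝓔 : ModuleDeformation D E} {h₀ : E →ₗ⋆[ℂ] E →ₗ[ℂ] A}
  (h : HermitianModuleDeformation 𝓔 h₀)

/-- The deformed inner product `𝐡 : 𝐄 × 𝐄 → 𝐀`. -/
def form : 𝓔.Mod → 𝓔.Mod → D.Alg := deformedForm 𝓔 h.coeff

theorem form_add (x y y' : 𝓔.Mod) : h.form x (y + y') = h.form x y + h.form x y' := by
  funext n
  change ∑ p ∈ Finset.HasAntidiagonal.antidiagonal n, ∑ q ∈ Finset.HasAntidiagonal.antidiagonal p.2,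
    h.coeff p.1 (x q.1) (y q.2 + y' q.2) = _
  simp only [map_add, Finset.sum_add_distrib]
  rfl

theorem form_smul (x y : 𝓔.Mod) (a : D.Alg) : h.form x (op a • y) = h.form x y * a :=
  h.right_linear x y a

/-- The endomorphism `Θ_{x,y} z = x • 𝐡(y, z)` of `𝐄`. -/
def theta (x y : 𝓔.Mod) : Module.End D.Algᵐᵒᵖ 𝓔.Mod where
  toFun z := op (h.form y z) • x
  map_add' z z' := by rw [h.form_add, op_add, add_smul]
  map_smul' a z := by
    obtain ⟨a, rfl⟩ := MulOpposite.op_surjective a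
    rw [h.form_smul, op_mul, mul_smul]; rfl

end HermitianModuleDeformation

end Deformations

/-! ## Smooth functions, Poisson structures, star products -/

section Geometry

variable {EM : Type*} [NormedAddCommGroup EM] [NormedSpace ℝ EM] {HM : Type*}
  [TopologicalSpace HM] (I : ModelWithCorners ℝ EM HM) (M : Type*) [TopologicalSpace M]
  [ChartedSpace HM M]

/-- The `*`-algebra `C^∞(M)` of complex-valued smooth functions, with complex conjugation. -/
def SmoothFunctions : StarSubalgebra ℂ (M → ℂ) where
  carrier := {f | ContMDiff I 𝓘(ℝ, ℂ) ∞ f}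
  mul_mem' {f g} hf hg := by
    have h : ContDiff ℝ ∞ (fun p : ℂ × ℂ => p.1 * p.2) := contDiff_mul
    exact h.contMDiff.comp (hf.prodMk_space hg)
  add_mem' {f g} hf hg := by
    have h : ContDiff ℝ ∞ (fun p : ℂ × ℂ => p.1 + p.2) := contDiff_add
    exact h.contMDiff.comp (hf.prodMk_space hg)
  algebraMap_mem' c := by
    change ContMDiff I 𝓘(ℝ, ℂ) ∞ (fun _ : M => c)
    exact contMDiff_const
  star_mem' {f} hf := by
    have h : ContDiff ℝ ∞ (fun z : ℂ => star z) := Complex.conjCLE.contDiff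
    exact h.contMDiff.comp hf

/-- A Poisson structure on `M`: a (real) Poisson bracket on `C^∞(M)`. -/
structure PoissonStructure where
  bracket : SmoothFunctions I M →ₗ[ℂ] SmoothFunctions I M →ₗ[ℂ] SmoothFunctions I M
  skew : ∀ f g, bracket f g = -bracket g f
  jacobi : ∀ f g h,
    bracket f (bracket g h) + bracket g (bracket h f) + bracket h (bracket f g) = 0
  leibniz : ∀ f g h, bracket f (g * h) = bracket f g * h + g * bracket f h
  real : ∀ f g, star (bracket f g) = bracket (star f) (star g)

variable {I M}

/-- A Hermitian star product on the Poisson manifold `(M, P)`: a Hermitian formal deformation of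
`C^∞(M)` with `C_1(f, g) - C_1(g, f) = i {f, g}`. -/
structure HermitianStarProduct (P : PoissonStructure I M) extends
    HermitianDeformation (SmoothFunctions I M) where
  semiclassical : ∀ f g, C 1 f g - C 1 g f = Complex.I • P.bracket f g

variable (I) (F : Type*) [NormedAddCommGroup F] [NormedSpace ℂ F]
  (E : M → Type*) [∀ x, AddCommGroup (E x)] [∀ x, Module ℂ (E x)]
  [TopologicalSpace (Bundle.TotalSpace F E)] [∀ x, TopologicalSpace (E x)] [FiberBundle F E]
  [VectorBundle ℂ F E]

theorem contMDiff_smul_section {f : M → ℂ} (hf : ContMDiff I 𝓘(ℝ, ℂ) ∞ f) {s : ∀ x, E x}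
    (hs : ContMDiff I (I.prod 𝓘(ℝ, F)) ∞ fun x => Bundle.TotalSpace.mk' F x (s x)) :
    ContMDiff I (I.prod 𝓘(ℝ, F)) ∞ fun x => Bundle.TotalSpace.mk' F x (f x • s x) := by
  intro x₀
  have hs' := (Bundle.contMDiffAt_section x₀).1 (hs x₀)
  rw [Bundle.contMDiffAt_section]
  have h : ContDiff ℝ ∞ (fun p : ℂ × F => p.1 • p.2) := contDiff_smul
  refine ((h.contMDiff.contMDiffAt (x := (f x₀, _))).comp x₀
    ((hf x₀).prodMk_space hs')).congr_of_eventuallyEq ?_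
  have hmem := (trivializationAt F E x₀).open_baseSet.mem_nhds
    (mem_baseSet_trivializationAt F E x₀)
  filter_upwards [hmem] with x hx
  exact ((trivializationAt F E x₀).linear ℂ hx).2 _ _

/-- The space `Γ^∞(E)` of smooth sections of the complex vector bundle `E → M`. -/
def SmoothSections : Submodule ℂ (∀ x, E x) where
  carrier := {s | ContMDiff I (I.prod 𝓘(ℝ, F)) ∞ fun x => Bundle.TotalSpace.mk' F x (s x)}
  add_mem' {s t} hs ht := by
    intro x₀
    have hs' := (Bundle.contMDiffAt_section x₀).1 (hs x₀)
    have ht' := (Bundle.contMDiffAt_section x₀).1 (ht x₀)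
    rw [Bundle.contMDiffAt_section]
    refine (hs'.add ht').congr_of_eventuallyEq ?_
    have hmem := (trivializationAt F E x₀).open_baseSet.mem_nhds
      (mem_baseSet_trivializationAt F E x₀)
    filter_upwards [hmem] with x hx
    exact ((trivializationAt F E x₀).linear ℂ hx).1 _ _
  zero_mem' := by
    intro x₀
    rw [Bundle.contMDiffAt_section]
    refine (contMDiffAt_const (c := (0 : F))).congr_of_eventuallyEq ?_
    have hmem := (trivializationAt F E x₀).open_baseSet.mem_nhds
      (mem_baseSet_trivializationAt F E x₀)
    filter_upwards [hmem] with x hx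
    have h := ((trivializationAt F E x₀).linear ℂ hx).2 0 0
    simpa using h
  smul_mem' c s hs := contMDiff_smul_section I F E contMDiff_const hs

/-- The right `C^∞(M)`-module structure of `Γ^∞(E)`. -/
instance : Module (SmoothFunctions I M)ᵐᵒᵖ (SmoothSections I F E) where
  smul f s := ⟨fun x => f.unop.1 x • s.1 x, contMDiff_smul_section I F E f.unop.2 s.2⟩
  one_smul s := Subtype.ext <| funext fun x => one_smul ℂ (s.1 x)
  mul_smul f g s := Subtype.ext <| funext fun x => by
    change (g.unop.1 x * f.unop.1 x) • s.1 x = f.unop.1 x • g.unop.1 x • s.1 x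
    rw [mul_comm, mul_smul]
  smul_zero f := Subtype.ext <| funext fun x => smul_zero (f.unop.1 x)
  smul_add f s t := Subtype.ext <| funext fun x => smul_add (f.unop.1 x) (s.1 x) (t.1 x)
  add_smul f g s := Subtype.ext <| funext fun x => add_smul (f.unop.1 x) (g.unop.1 x) (s.1 x)
  zero_smul s := Subtype.ext <| funext fun x => zero_smul ℂ (s.1 x)

/-- A Hermitian fiber metric on `E` (antilinear in the first argument), depending smoothly on the
base point: the inner product of any two smooth sections is a smooth function. -/
structure HermitianMetric where
  inner : ∀ x, E x →ₗ⋆[ℂ] E x →ₗ[ℂ] ℂ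
  conj_symm : ∀ x v w, star (inner x v w) = inner x w v
  pos : ∀ x v, v ≠ 0 → 0 < (inner x v v).re
  smooth : ∀ s t : SmoothSections I F E,
    ContMDiff I 𝓘(ℝ, ℂ) ∞ fun x => inner x (s.1 x) (t.1 x)

variable {I F E}

/-- The `C^∞(M)`-valued inner product on `Γ^∞(E)` given by a Hermitian fiber metric. -/
def HermitianMetric.sectionForm (g : HermitianMetric I F E) :
    SmoothSections I F E →ₗ⋆[ℂ] SmoothSections I F E →ₗ[ℂ] SmoothFunctions I M :=
  LinearMap.mk₂'ₛₗ (starRingEnd ℂ) (RingHom.id ℂ)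
    (fun s t => ⟨fun x => g.inner x (s.1 x) (t.1 x), g.smooth s t⟩)
    (fun s s' t => Subtype.ext <| funext fun x => by simp)
    (fun c s t => Subtype.ext <| funext fun x => by simp)
    (fun s t t' => Subtype.ext <| funext fun x => by simp)
    (fun c s t => Subtype.ext <| funext fun x => by simp)

end Geometry

end

/-! Geometry enters through one finite object, a tight frame: global sections e_1, …, e_N with Σ e_i
h₀(e_i, s) = s for every s and Σ h₀(e_i, e_i) = k. The rest is λ-adic algebra, valid for Hermitian
deformations of any unital `*`-algebra that has such a frame and a family w with Σ h₀(w_i, w_i) = 1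
(here w = e/√k).

Existence of 𝐡: the Gram matrix (h₀(e_i, e_j)) is idempotent. It lifts to an idempotent P over 𝐀
(`exists_idempotent_matrix`), and v ↦ Σ e_i • v_i maps the fixed vectors of P bijectively onto 𝐄,
because it does so modulo λ. The inverse j embeds 𝐄 in 𝐀ᴺ (`exists_deformed_embedding`), and 𝐡(x, y)
= Σ j(x)_i* ⋆ j(y)_i is positive as a sum of squares, with zeroth order h₀ by tightness.

Morita equivalence: for any 𝐡 the frame operator T = Σ Θ(e_i, e_i) is 1 modulo λ, so it has an
inverse square root S, and the S e_i satisfy Σ Θ(S e_i, S e_i) = STS = 1. In the same way a = Σ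
𝐡(w_i, w_i) is 1 modulo λ, and u_i = w_i • a^(-1/2) satisfies Σ 𝐡(u_i, u_i) = 1. These two
decompositions of unity give the adjoints, fullness, the positivity of Θ, and (P) and (Q), since
they turn the inner products into finite sums of squares
(`IsRankOne.isNondegenerateEquivalenceBimodule`).

The frame: M need not be compact. Over a compact set finitely many sections span, and a generic
perturbation, found by counting Hausdorff dimensions, lowers their number to a bound independent of
the set (`exists_uniform_spanning`). Gluing along a compact exhaustion gives finitely many spanning
sections; Gram–Schmidt on the finitely many open sets where a choice of them is a basis, weighted by
functions whose squares sum to 1, gives the tight frame. -/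

set_option linter.unusedSectionVars false

/-! ## `λ`-adically complete modules over `ℂ[[λ]]` -/

/-- A `λ`-adically complete and separated `ℂ[[λ]]`-module: there is a summation operator for the
series `∑ λⁿ uₙ`. -/
structure FormalComplete (Y : Type*) [AddCommGroup Y] [Module ℂ⟦X⟧ Y] : Prop where
  haus : ∀ y : Y, (∀ k : ℕ, ∃ z : Y, y = (PowerSeries.X : ℂ⟦X⟧) ^ k • z) → y = 0
  exists_sum : ∃ S : (ℕ → Y) → Y,
    ∀ u, S u = u 0 + (PowerSeries.X : ℂ⟦X⟧) • S (fun n => u (n + 1))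

namespace FormalComplete

variable {Y : Type*} [AddCommGroup Y] [Module ℂ⟦X⟧ Y]

theorem eq_zero_of_mem (hY : FormalComplete Y) (K : Set Y)
    (hK : ∀ v ∈ K, ∃ w ∈ K, v = (PowerSeries.X : ℂ⟦X⟧) • w) {v : Y} (hv : v ∈ K) : v = 0 := by
  refine hY.haus v fun k => ?_
  suffices h : ∃ z ∈ K, v = (PowerSeries.X : ℂ⟦X⟧) ^ k • z from ⟨h.choose, h.choose_spec.2⟩
  induction k with
  | zero => exact ⟨v, hv, by simp⟩
  | succ k ih =>
    obtain ⟨z, hz, rfl⟩ := ih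
    obtain ⟨w, hw, rfl⟩ := hK z hz
    exact ⟨w, hw, by rw [pow_succ, mul_smul]⟩

/-- The uniqueness principle that replaces limits: to prove an identity, index all its instances by
`ι` and show that each defect is λ times another one; separatedness then kills them all. -/
theorem eq_zero_of_recursion (hY : FormalComplete Y) {ι : Type*} (d : ι → Y)
    (hd : ∀ i, ∃ j, d i = (PowerSeries.X : ℂ⟦X⟧) • d j) (i : ι) : d i = 0 :=
  hY.eq_zero_of_mem (Set.range d)
    (by rintro _ ⟨i, rfl⟩; obtain ⟨j, hj⟩ := hd i; exact ⟨d j, ⟨j, rfl⟩, hj⟩) ⟨i, rfl⟩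

theorem pi {ι : Type*} {Z : ι → Type*} [∀ i, AddCommGroup (Z i)] [∀ i, Module ℂ⟦X⟧ (Z i)]
    (h : ∀ i, FormalComplete (Z i)) : FormalComplete (∀ i, Z i) where
  haus y hy := funext fun i => (h i).haus _ fun k => by
    obtain ⟨z, rfl⟩ := hy k
    exact ⟨z i, rfl⟩
  exists_sum := by
    choose S hS using fun i => (h i).exists_sum
    exact ⟨fun u i => S i fun n => u n i, fun u => funext fun i => hS i _⟩

theorem matrix {m n : Type*} (hY : FormalComplete Y) : FormalComplete (Matrix m n Y) :=
  FormalComplete.pi (Z := fun _ : m => n → Y) fun _ =>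
    FormalComplete.pi (Z := fun _ : n => Y) fun _ => hY

/-- Endomorphisms are summed pointwise. The summation operator is not assumed additive or
`R`-linear, but its defects of linearity satisfy the λ-recursion and so vanish. -/
theorem moduleEnd {R : Type*} [Ring R] [Module R Y] [SMulCommClass R ℂ⟦X⟧ Y]
    (hY : FormalComplete Y) : FormalComplete (Module.End R Y) where
  haus T hT := LinearMap.ext fun x => hY.haus _ fun k => by
    obtain ⟨z, rfl⟩ := hT k
    exact ⟨z x, rfl⟩
  exists_sum := by
    obtain ⟨S, hS⟩ := hY.exists_sum
    have hadd : ∀ p : (ℕ → Y) × (ℕ → Y),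
        S (fun n => p.1 n + p.2 n) - S p.1 - S p.2 = 0 :=
      hY.eq_zero_of_recursion _ fun p => ⟨(fun n => p.1 (n + 1), fun n => p.2 (n + 1)), by
        rw [hS (fun n => p.1 n + p.2 n), hS p.1, hS p.2, smul_sub, smul_sub]; abel⟩
    have hsmul : ∀ (r : R) (u : ℕ → Y), S (fun n => r • u n) - r • S u = 0 := fun r =>
      hY.eq_zero_of_recursion _ fun u => ⟨fun n => u (n + 1), by
        rw [hS (fun n => r • u n), hS u, smul_sub, smul_add, smul_comm r]; abel⟩
    refine ⟨fun T => ⟨⟨fun x => S fun n => T n x, fun x y => ?_⟩, fun r x => ?_⟩,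
      fun T => LinearMap.ext fun x => hS _⟩
    · have := hadd (fun n => T n x, fun n => T n y)
      simp only [map_add]
      rwa [sub_sub, sub_eq_zero] at this
    · have := hsmul r fun n => T n x
      simpa only [map_smul, sub_eq_zero, RingHom.id_apply] using this

end FormalComplete

/-! ### Completeness of V[[λ]] -/

namespace FormalSeries

variable {V : Type*} [AddCommGroup V] [Module ℂ V]

theorem X_smul_zero (x : FormalSeries V) : ((PowerSeries.X : ℂ⟦X⟧) • x) 0 = 0 := by
  simp [smul_apply]

theorem X_smul_succ (x : FormalSeries V) (n : ℕ) :
    ((PowerSeries.X : ℂ⟦X⟧) • x) (n + 1) = x n := by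
  rw [smul_apply, Finset.sum_eq_single (1, n)]
  · simp
  · rintro ⟨a, b⟩ hp hne
    have ha : a ≠ 1 := by
      rintro rfl
      simp only [Finset.HasAntidiagonal.mem_antidiagonal] at hp
      exact hne (by rw [show b = n by omega])
    simp [PowerSeries.coeff_X, ha]
  · simp [add_comm]

theorem X_smul_injective {x y : FormalSeries V}
    (h : (PowerSeries.X : ℂ⟦X⟧) • x = (PowerSeries.X : ℂ⟦X⟧) • y) : x = y :=
  funext fun n => by rw [← X_smul_succ x n, h, X_smul_succ]

/-- The tail `∑ x_{n+1} λⁿ`. -/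
def tail (x : FormalSeries V) : FormalSeries V := fun n => x (n + 1)

theorem eq_const_add (x : FormalSeries V) :
    x = const (x 0) + (PowerSeries.X : ℂ⟦X⟧) • tail x := by
  funext n
  cases n with
  | zero => rw [add_apply, X_smul_zero, add_zero]; rfl
  | succ n =>
    rw [add_apply, X_smul_succ, show const (x 0) (n + 1) = 0 from if_neg n.succ_ne_zero, zero_add]
    rfl

theorem eq_X_smul_tail {x : FormalSeries V} (h : x 0 = 0) :
    x = (PowerSeries.X : ℂ⟦X⟧) • tail x := by
  funext n
  cases n with
  | zero => rw [X_smul_zero, h]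
  | succ n => rw [X_smul_succ]; rfl

theorem X_pow_smul_apply_of_lt (x : FormalSeries V) {k n : ℕ} (h : n < k) :
    ((PowerSeries.X : ℂ⟦X⟧) ^ k • x) n = 0 := by
  rw [smul_apply]
  refine Finset.sum_eq_zero fun p hp => ?_
  have := Finset.HasAntidiagonal.mem_antidiagonal.1 hp
  rw [PowerSeries.coeff_X_pow, if_neg (by omega), zero_smul]

/-- The series `∑ λⁿ uₙ`. -/
def sumSeries (u : ℕ → FormalSeries V) : FormalSeries V :=
  fun n => ∑ p ∈ Finset.HasAntidiagonal.antidiagonal n, u p.1 p.2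

theorem sumSeries_eq (u : ℕ → FormalSeries V) :
    sumSeries u = u 0 + (PowerSeries.X : ℂ⟦X⟧) • sumSeries fun n => u (n + 1) := by
  funext n
  cases n with
  | zero => rw [add_apply, X_smul_zero]; simp [sumSeries]
  | succ n =>
    rw [add_apply, X_smul_succ, sumSeries, Finset.Nat.sum_antidiagonal_succ]
    rfl

theorem formalComplete : FormalComplete (FormalSeries V) where
  haus y hy := funext fun n => by
    obtain ⟨z, rfl⟩ := hy (n + 1)
    exact X_pow_smul_apply_of_lt z n.lt_succ_self
  exists_sum := ⟨sumSeries, sumSeries_eq⟩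

end FormalSeries

/-! ## Functional calculus for topologically nilpotent elements -/

section FunctionalCalculus

variable {R : Type*} [Ring R] [Algebra ℂ⟦X⟧ R]

/-- Drop the constant term of a power series and divide by the variable. -/
noncomputable def PowerSeries.shift {K : Type*} [Semiring K] (f : PowerSeries K) : PowerSeries K :=
  PowerSeries.mk fun n => PowerSeries.coeff (n + 1) f

theorem PowerSeries.eq_shift {K : Type*} [CommSemiring K] (f : PowerSeries K) :
    f = PowerSeries.C (PowerSeries.constantCoeff f) + PowerSeries.X * f.shift := by
  rw [add_comm, mul_comm]
  exact PowerSeries.eq_shift_mul_X_add_const f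

-- `G f` is the sum Σ f_n λⁿ Nⁿ, which converges λ-adically for arbitrary `N`. Only its recursion is
-- recorded, since together with separatedness this determines `G`.
open PowerSeries in
theorem FormalComplete.exists_functionalCalculus (hR : FormalComplete R) (N : R) :
    ∃ G : ℚ⟦X⟧ → R,
      ∀ f, G f = algebraMap ℂ⟦X⟧ R (algebraMap ℚ ℂ⟦X⟧ (constantCoeff f)) +
        (PowerSeries.X : ℂ⟦X⟧) • (N * G f.shift) := by
  obtain ⟨S, hS⟩ := hR.exists_sum
  have hmul : ∀ u : ℕ → R, S (fun n => N * u n) - N * S u = 0 :=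
    hR.eq_zero_of_recursion _ fun u => ⟨fun n => u (n + 1), by
      rw [hS (fun n => N * u n), hS u, smul_sub, mul_add, mul_smul_comm]; abel⟩
  refine ⟨fun f => S fun n => N ^ n * algebraMap ℂ⟦X⟧ R (algebraMap ℚ ℂ⟦X⟧ (coeff n f)),
    fun f => ?_⟩
  beta_reduce
  rw [hS]
  congr 2
  · simp
  · rw [← sub_eq_zero.1 (hmul _)]
    congr 1
    funext n
    rw [pow_succ', mul_assoc]
    simp [PowerSeries.shift]

open PowerSeries in
/-- `G` is the substitution `f ↦ f(λN)`. -/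
def IsFunctionalCalculus (N : R) (G : ℚ⟦X⟧ → R) : Prop :=
  ∀ f, G f = algebraMap ℂ⟦X⟧ R (algebraMap ℚ ℂ⟦X⟧ (constantCoeff f)) +
    (PowerSeries.X : ℂ⟦X⟧) • (N * G f.shift)

namespace IsFunctionalCalculus

open PowerSeries

variable {N : R} {G : ℚ⟦X⟧ → R}

theorem map_add (hG : IsFunctionalCalculus N G) (hR : FormalComplete R) (f g : ℚ⟦X⟧) :
    G (f + g) = G f + G g := by
  -- An arbitrary left factor `a` closes the family of defects under the recursion, which replaces
  -- `a` by `a * N`.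
  suffices h : ∀ p : R × ℚ⟦X⟧ × ℚ⟦X⟧, p.1 * (G (p.2.1 + p.2.2) - G p.2.1 - G p.2.2) = 0 by
    have := h (1, f, g)
    rwa [one_mul, sub_sub, sub_eq_zero] at this
  refine hR.eq_zero_of_recursion _ fun ⟨a, f, g⟩ => ⟨(a * N, f.shift, g.shift), ?_⟩
  have hs : (f + g).shift = f.shift + g.shift := by ext; simp [PowerSeries.shift]
  dsimp only
  rw [hG (f + g), hG f, hG g, hs]
  simp only [_root_.map_add, mul_add, mul_sub, smul_sub, mul_smul_comm, mul_assoc]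
  abel

theorem map_C_mul (hG : IsFunctionalCalculus N G) (hR : FormalComplete R) (c : ℚ) (f : ℚ⟦X⟧) :
    G (C c * f) = algebraMap ℂ⟦X⟧ R (algebraMap ℚ ℂ⟦X⟧ c) * G f := by
  suffices h : ∀ p : R × ℚ⟦X⟧,
      p.1 * (G (C c * p.2) - algebraMap ℂ⟦X⟧ R (algebraMap ℚ ℂ⟦X⟧ c) * G p.2) = 0 by
    have := h (1, f)
    rwa [one_mul, sub_eq_zero] at this
  refine hR.eq_zero_of_recursion _ fun ⟨a, f⟩ => ⟨(a * N, f.shift), ?_⟩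
  have hs : (C c * f).shift = C c * f.shift := by ext; simp [PowerSeries.shift]
  dsimp only
  rw [hG (C c * f), hG f, hs]
  simp only [_root_.map_mul, mul_add, mul_sub, smul_sub, mul_smul_comm, mul_assoc,
    constantCoeff_C, Algebra.left_comm N]
  abel

theorem map_X_mul (hG : IsFunctionalCalculus N G) (f : ℚ⟦X⟧) :
    G (PowerSeries.X * f) = (PowerSeries.X : ℂ⟦X⟧) • (N * G f) := by
  have hs : (PowerSeries.X * f).shift = f := by ext; simp [PowerSeries.shift]
  rw [hG, hs]
  simp

theorem map_zero (hG : IsFunctionalCalculus N G) (hR : FormalComplete R) : G 0 = 0 := by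
  have := hG.map_add hR 0 0
  simpa using this

theorem map_C (hG : IsFunctionalCalculus N G) (hR : FormalComplete R) (c : ℚ) :
    G (C c) = algebraMap ℂ⟦X⟧ R (algebraMap ℚ ℂ⟦X⟧ c) := by
  have hs : (C c : ℚ⟦X⟧).shift = 0 := by ext; simp [PowerSeries.shift]
  rw [hG, hs, hG.map_zero hR]
  simp

theorem map_mul (hG : IsFunctionalCalculus N G) (hR : FormalComplete R) (f g : ℚ⟦X⟧) :
    G (f * g) = G f * G g := by
  suffices h : ∀ p : R × ℚ⟦X⟧, p.1 * (G (p.2 * g) - G p.2 * G g) = 0 by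
    have := h (1, f)
    rwa [one_mul, sub_eq_zero] at this
  refine hR.eq_zero_of_recursion _ fun ⟨a, f⟩ => ⟨(a * N, f.shift), ?_⟩
  dsimp only
  have h1 : G (f * g) = algebraMap ℂ⟦X⟧ R (algebraMap ℚ ℂ⟦X⟧ (constantCoeff f)) * G g +
      (PowerSeries.X : ℂ⟦X⟧) • (N * G (f.shift * g)) := by
    conv_lhs => rw [PowerSeries.eq_shift f, add_mul, mul_assoc, hG.map_add hR,
      hG.map_C_mul hR, hG.map_X_mul]
  rw [h1, hG f]
  simp only [mul_add, mul_sub, add_mul, smul_sub, mul_smul_comm, smul_mul_assoc, mul_assoc]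
  abel

theorem commute (hG : IsFunctionalCalculus N G) (hR : FormalComplete R) {T : R}
    (hT : Commute T N) (f : ℚ⟦X⟧) : Commute T (G f) := by
  suffices h : ∀ p : R × ℚ⟦X⟧, p.1 * (T * G p.2 - G p.2 * T) = 0 by
    have := h (1, f)
    rwa [one_mul, sub_eq_zero] at this
  refine hR.eq_zero_of_recursion _ fun ⟨a, f⟩ => ⟨(a * N, f.shift), ?_⟩
  dsimp only
  rw [hG f]
  simp only [mul_add, mul_sub, add_mul, smul_sub, mul_smul_comm, smul_mul_assoc, mul_assoc,
    ← Algebra.commutes]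
  rw [← mul_assoc T N, hT.eq, mul_assoc]
  abel

theorem star_eq [StarRing R] [StarModule ℂ⟦X⟧ R] (hG : IsFunctionalCalculus N G)
    (hR : FormalComplete R) (hN : star N = N) (f : ℚ⟦X⟧) : star (G f) = G f := by
  suffices h : ∀ p : R × ℚ⟦X⟧, p.1 * (star (G p.2) - G p.2) = 0 by
    have := h (1, f)
    rwa [one_mul, sub_eq_zero] at this
  refine hR.eq_zero_of_recursion _ fun ⟨a, f⟩ => ⟨(a * N, f.shift), ?_⟩
  dsimp only
  have hX : star (PowerSeries.X : ℂ⟦X⟧) = PowerSeries.X := by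
    ext n; rw [coeff_star_formal, coeff_X]; split_ifs <;> simp
  have hc : star (algebraMap ℚ ℂ⟦X⟧ (constantCoeff f)) =
      algebraMap ℚ ℂ⟦X⟧ (constantCoeff f) := by
    ext n
    rw [coeff_star_formal, PowerSeries.algebraMap_apply, coeff_C]
    split_ifs <;> simp
  rw [hG f, star_add, star_smul, hX, (hG.commute hR (Commute.refl N) f.shift).eq, star_mul, hN,
    ← algebraMap_star_comm, hc, ← (hG.commute hR (Commute.refl N) f.shift).eq]
  simp only [mul_add, mul_sub, smul_sub, mul_smul_comm, mul_assoc]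
  abel

end IsFunctionalCalculus

-- The binomial series (1 + X)^(-1/2). Its rational coefficients are fixed by conjugation, so a
-- Hermitian `N` yields a Hermitian inverse square root.
open PowerSeries in
theorem exists_rat_inv_sqrt : ∃ s : ℚ⟦X⟧, constantCoeff s = 1 ∧ s * s * (1 + PowerSeries.X) = 1 := by
  refine ⟨PowerSeries.binomialSeries ℚ (-1 / 2 : ℚ), by simp, ?_⟩
  have h1 : (1 + PowerSeries.X : ℚ⟦X⟧) = PowerSeries.binomialSeries ℚ (1 : ℚ) := by
    have := binomialSeries_nat (R := ℚ) (A := ℚ) 1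
    simpa using this.symm
  rw [h1, ← binomialSeries_add, ← binomialSeries_add]
  norm_num

/-- Inverse square roots of `1 + λN`. -/
theorem FormalComplete.exists_inv_sqrt (hR : FormalComplete R) (N : R) :
    ∃ S Y : R, S = 1 + (PowerSeries.X : ℂ⟦X⟧) • Y ∧
      S * S * (1 + (PowerSeries.X : ℂ⟦X⟧) • N) = 1 ∧ (∀ T, Commute T N → Commute T S) ∧
      ∀ [StarRing R] [StarModule ℂ⟦X⟧ R], star N = N → star S = S := by
  obtain ⟨G, hG⟩ := hR.exists_functionalCalculus N
  replace hG : IsFunctionalCalculus N G := hG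
  obtain ⟨s, hs0, hs⟩ := exists_rat_inv_sqrt
  have h1 : G 1 = 1 := by simpa using hG.map_C hR 1
  refine ⟨G s, N * G s.shift, ?_, ?_, fun T hT => hG.commute hR hT s, fun hN =>
    hG.star_eq hR hN s⟩
  · rw [hG s, hs0]; simp
  · have h2 := hG.map_X_mul 1
    rw [mul_one, h1, mul_one] at h2
    rw [← h1, ← h2, ← hG.map_add hR, ← hG.map_mul hR, ← hG.map_mul hR, hs]

/-- Idempotents modulo `λ` lift to idempotents. -/
theorem FormalComplete.exists_idempotent (hR : FormalComplete R)
    (hX : ∀ y : R, (PowerSeries.X : ℂ⟦X⟧) • y = 0 → y = 0) {Q N : R}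
    (hQ : Q * Q - Q = (PowerSeries.X : ℂ⟦X⟧) • N) :
    ∃ P Y : R, P * P = P ∧ P = Q + (PowerSeries.X : ℂ⟦X⟧) • Y := by
  -- λN = Q² − Q commutes with Q, and λ can be cancelled.
  have hQN : Commute Q N := by
    refine sub_eq_zero.1 (hX _ ?_)
    rw [smul_sub, ← mul_smul_comm, ← smul_mul_assoc, ← hQ, mul_sub, sub_mul, mul_assoc, sub_self]
  -- Since (Q − 1/2)² = (1 + 4λN)/4, multiplying Q − 1/2 by S = (1 + 4λN)^(-1/2) gives an element of
  -- square 1/4; adding 1/2 makes it idempotent. Below, `h` is the scalar 1/2.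
  obtain ⟨S, Y, hS, hS1, hS2, -⟩ := hR.exists_inv_sqrt ((4 : ℂ⟦X⟧) • N)
  have hQS : Commute Q S := hS2 Q (hQN.smul_right _)
  obtain ⟨h, hh, hc⟩ : ∃ h : R, h + h = 1 ∧ ∀ T : R, Commute h T := by
    refine ⟨algebraMap ℂ⟦X⟧ R (PowerSeries.C (1 / 2)), ?_, Algebra.commutes _⟩
    rw [← map_add, ← map_add]
    norm_num
  have hh2 : h * h + h * h = h := by rw [← mul_add, hh, mul_one]
  have h4 : (4 : ℂ⟦X⟧) • (h * h) = 1 := by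
    have : (4 : ℂ⟦X⟧) • (h * h) = (h + h) * (h + h) := by
      rw [show (4 : ℂ⟦X⟧) = 1 + 1 + 1 + 1 by norm_num]
      simp only [add_smul, one_smul, add_mul, mul_add]
      abel
    rw [this, hh, mul_one]
  have hD0 : (Q - h) * (Q - h) = h * h * (1 + (PowerSeries.X : ℂ⟦X⟧) • (4 : ℂ⟦X⟧) • N) := by
    rw [mul_add, mul_one, smul_comm, ← hQ, mul_smul_comm, ← smul_mul_assoc, h4, one_mul]
    have : Q = h * Q + h * Q := by rw [← add_mul, hh, one_mul]
    have h5 : (Q - h) * (Q - h) = h * h + Q * Q - (h * Q + h * Q) := by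
      rw [sub_mul, mul_sub, mul_sub, ← (hc Q).eq]; abel
    rw [h5, ← this]; abel
  have hD : (Q - h) * S * ((Q - h) * S) = h * h := by
    have hcS : Commute (Q - h) S := hQS.sub_left (hc S)
    have h6 : Commute S (h * h * (1 + (PowerSeries.X : ℂ⟦X⟧) • (4 : ℂ⟦X⟧) • N)) := by
      rw [← hD0]; exact (hcS.mul_left hcS).symm
    calc (Q - h) * S * ((Q - h) * S) = (Q - h) * (S * (Q - h)) * S := by simp only [mul_assoc]
      _ = ((Q - h) * (Q - h)) * (S * S) := by rw [← hcS.eq]; simp only [mul_assoc]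
      _ = h * h * (1 + (PowerSeries.X : ℂ⟦X⟧) • (4 : ℂ⟦X⟧) • N) * (S * S) := by rw [hD0]
      _ = (S * S) * (h * h * (1 + (PowerSeries.X : ℂ⟦X⟧) • (4 : ℂ⟦X⟧) • N)) :=
          (h6.mul_left h6).eq.symm
      _ = h * h * (S * S * (1 + (PowerSeries.X : ℂ⟦X⟧) • (4 : ℂ⟦X⟧) • N)) := by
          rw [← mul_assoc, ← ((hc (S * S)).mul_left (hc (S * S))).eq, mul_assoc]
      _ = h * h := by rw [hS1, mul_one]
  refine ⟨h + (Q - h) * S, (Q - h) * Y, ?_, ?_⟩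
  · rw [add_mul, mul_add, mul_add, hD, ← (hc ((Q - h) * S)).eq]
    calc _ = (h * h + h * h) + (h + h) * ((Q - h) * S) := by rw [add_mul]; abel
      _ = _ := by rw [hh2, hh, one_mul]
  · rw [hS, mul_add, mul_one, mul_smul_comm]; abel

end FunctionalCalculus

/-! ## The classical limit -/

theorem FormalSeries.const_apply_zero {V : Type*} [AddCommGroup V] (v : V) :
    FormalSeries.const v 0 = v := if_pos rfl

section Deformations

universe u v

variable {A : Type u} [Ring A] [Algebra ℂ A] [StarRing A]

namespace HermitianDeformation

variable (D : HermitianDeformation A)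

theorem formalComplete : FormalComplete D.Alg := FormalSeries.formalComplete (V := A)

/-- The classical limit `λ = 0`. -/
def zeroth : D.Alg →+* A where
  toFun a := (show FormalSeries A from a) 0
  map_one' := FormalSeries.const_apply_zero (1 : A)
  map_mul' a b := by
    change FormalSeries.ext2 (fun r v w => D.C r v w) _ _ 0 = _
    simp [FormalSeries.ext2, D.C_zero]
  map_zero' := rfl
  map_add' _ _ := rfl

/-- The constant series. -/
noncomputable def ofConst (a : A) : D.Alg := FormalSeries.const a

theorem zeroth_ofConst (a : A) : D.zeroth (D.ofConst a) = a :=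
  FormalSeries.const_apply_zero a

theorem zeroth_star (a : D.Alg) : D.zeroth (star a) = star (D.zeroth a) := rfl

theorem zeroth_X_smul (a : D.Alg) : D.zeroth ((PowerSeries.X : ℂ⟦X⟧) • a) = 0 :=
  FormalSeries.X_smul_zero (V := A) a

theorem exists_eq_X_smul {a : D.Alg} (h : D.zeroth a = 0) :
    ∃ b, a = (PowerSeries.X : ℂ⟦X⟧) • b :=
  ⟨_, FormalSeries.eq_X_smul_tail (V := A) h⟩

theorem X_smul_injective {a b : D.Alg}
    (h : (PowerSeries.X : ℂ⟦X⟧) • a = (PowerSeries.X : ℂ⟦X⟧) • b) : a = b :=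
  FormalSeries.X_smul_injective (V := A) h

end HermitianDeformation

variable {E : Type v} [AddCommGroup E] [Module ℂ E] [Module Aᵐᵒᵖ E] {D : HermitianDeformation A}

namespace ModuleDeformation

variable (𝓔 : ModuleDeformation D E)

theorem formalComplete : FormalComplete 𝓔.Mod := FormalSeries.formalComplete (V := E)

/-- The classical limit `λ = 0`. -/
def zeroth : 𝓔.Mod →+ E where
  toFun a := (show FormalSeries E from a) 0
  map_zero' := rfl
  map_add' _ _ := rfl

/-- The constant series. -/
noncomputable def ofConst (x : E) : 𝓔.Mod := FormalSeries.const x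

theorem zeroth_ofConst (x : E) : 𝓔.zeroth (𝓔.ofConst x) = x :=
  FormalSeries.const_apply_zero x

theorem zeroth_smul (a : D.Alg) (x : 𝓔.Mod) :
    𝓔.zeroth (op a • x) = op (D.zeroth a) • 𝓔.zeroth x := by
  change FormalSeries.ext2 (fun r v w => 𝓔.R r v w) _ _ 0 = _
  simp [FormalSeries.ext2, 𝓔.R_zero]
  rfl

theorem exists_eq_X_smul {a : 𝓔.Mod} (h : 𝓔.zeroth a = 0) :
    ∃ b, a = (PowerSeries.X : ℂ⟦X⟧) • b :=
  ⟨_, FormalSeries.eq_X_smul_tail (V := E) h⟩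

theorem X_smul_injective {a b : 𝓔.Mod}
    (h : (PowerSeries.X : ℂ⟦X⟧) • a = (PowerSeries.X : ℂ⟦X⟧) • b) : a = b :=
  FormalSeries.X_smul_injective (V := E) h

theorem smul_one_smul (z : ℂ⟦X⟧) (x : 𝓔.Mod) : op (z • (1 : D.Alg)) • x = z • x := by
  rw [op_smul, smul_assoc, op_one, one_smul]

end ModuleDeformation

/-! ## Formal sesquilinear maps -/

theorem X_star_formal : star (PowerSeries.X : ℂ⟦X⟧) = PowerSeries.X := by
  ext n; rw [coeff_star_formal, PowerSeries.coeff_X]; split_ifs <;> simp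

namespace FormalSeries

variable {U V W : Type*} [AddCommGroup U] [AddCommGroup V] [AddCommGroup W] [Module ℂ U]
  [Module ℂ V] [Module ℂ W]

theorem const_add (v w : V) : const (v + w) = const v + const w := by
  funext n; rw [add_apply]; unfold const; split_ifs <;> simp

theorem const_smul (c : ℂ) (v : V) : const (c • v) = (PowerSeries.C c : ℂ⟦X⟧) • const v := by
  funext n
  rw [smul_apply, Finset.sum_eq_single (0, n)]
  · unfold const; split_ifs <;> simp
  · rintro ⟨a, b⟩ hp hne
    have ha : a ≠ 0 := by
      rintro rfl
      simp only [Finset.HasAntidiagonal.mem_antidiagonal, zero_add] at hp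
      exact hne (by rw [hp])
    simp [PowerSeries.coeff_C, ha]
  · simp

theorem ext2_const (B : ℕ → V →ₗ⋆[ℂ] W →ₗ[ℂ] U) (v : V) (w : W) (n : ℕ) :
    ext2 (fun r v w => B r v w) (const v) (const w) n = B n v w := by
  unfold ext2
  rw [Finset.sum_eq_single (n, 0)]
  · simp [const]
  · rintro ⟨a, b⟩ hp hne
    have hb : b ≠ 0 := by
      rintro rfl
      simp only [Finset.HasAntidiagonal.mem_antidiagonal, add_zero] at hp
      exact hne (by rw [hp])
    refine Finset.sum_eq_zero fun q hq => ?_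
    have := Finset.HasAntidiagonal.mem_antidiagonal.1 hq
    dsimp only [const] at *
    by_cases h1 : q.1 = 0
    · rw [if_neg (show q.2 ≠ 0 by omega), map_zero]
    · rw [if_neg h1, map_zero, LinearMap.zero_apply]
  · simp

variable (B : ℕ → V →ₗ⋆[ℂ] W →ₗ[ℂ] U)

theorem sesq_add_left (x x' : FormalSeries V) (y : FormalSeries W) :
    ext2 (fun r v w => B r v w) (x + x') y =
      ext2 (fun r v w => B r v w) x y + ext2 (fun r v w => B r v w) x' y := by
  funext n
  simp [ext2, add_apply, Finset.sum_add_distrib]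

theorem sesq_add_right (x : FormalSeries V) (y y' : FormalSeries W) :
    ext2 (fun r v w => B r v w) x (y + y') =
      ext2 (fun r v w => B r v w) x y + ext2 (fun r v w => B r v w) x y' := by
  funext n
  simp [ext2, add_apply, Finset.sum_add_distrib]

theorem sesq_X_smul_right (x : FormalSeries V) (y : FormalSeries W) :
    ext2 (fun r v w => B r v w) x ((PowerSeries.X : ℂ⟦X⟧) • y) =
      (PowerSeries.X : ℂ⟦X⟧) • ext2 (fun r v w => B r v w) x y := by
  funext n
  cases n with
  | zero => rw [X_smul_zero]; simp [ext2, X_smul_zero]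
  | succ n =>
    rw [X_smul_succ, ext2, Finset.Nat.sum_antidiagonal_succ']
    simp only [Finset.Nat.sum_antidiagonal_succ', X_smul_succ, X_smul_zero, map_zero, zero_add,
      Finset.HasAntidiagonal.antidiagonal_zero, Finset.sum_singleton, ext2]

theorem sesq_X_smul_left (x : FormalSeries V) (y : FormalSeries W) :
    ext2 (fun r v w => B r v w) ((PowerSeries.X : ℂ⟦X⟧) • x) y =
      (PowerSeries.X : ℂ⟦X⟧) • ext2 (fun r v w => B r v w) x y := by
  funext n
  cases n with
  | zero => rw [X_smul_zero]; simp [ext2, X_smul_zero]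
  | succ n =>
    rw [X_smul_succ, ext2, Finset.Nat.sum_antidiagonal_succ']
    simp only [Finset.Nat.sum_antidiagonal_succ, X_smul_succ, X_smul_zero, map_zero, zero_add,
      Finset.HasAntidiagonal.antidiagonal_zero, Finset.sum_singleton, ext2, LinearMap.zero_apply]

/-- A biadditive map that commutes with `λ` in both arguments is determined by its values on
constant series. -/
theorem eq_ext2 {β : FormalSeries V → FormalSeries W → FormalSeries U}
    (hl : ∀ x x' y, β (x + x') y = β x y + β x' y) (hr : ∀ x y y', β x (y + y') = β x y + β x y')
    (hXl : ∀ x y, β ((PowerSeries.X : ℂ⟦X⟧) • x) y = (PowerSeries.X : ℂ⟦X⟧) • β x y)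
    (hXr : ∀ x y, β x ((PowerSeries.X : ℂ⟦X⟧) • y) = (PowerSeries.X : ℂ⟦X⟧) • β x y)
    (hB : ∀ v w n, β (const v) (const w) n = B n v w) (x : FormalSeries V) (y : FormalSeries W) :
    β x y = ext2 (fun r v w => B r v w) x y := by
  have h1 : ∀ p : V × FormalSeries W,
      β (const p.1) p.2 - ext2 (fun r v w => B r v w) (const p.1) p.2 = 0 := by
    refine formalComplete.eq_zero_of_recursion _ fun ⟨v, y⟩ => ⟨(v, tail y), ?_⟩
    dsimp only
    conv_lhs => rw [eq_const_add y]
    rw [hr, sesq_add_right, hXr, sesq_X_smul_right, smul_sub]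
    have : β (const v) (const (y 0)) = ext2 (fun r v w => B r v w) (const v) (const (y 0)) := by
      funext n; rw [hB, ext2_const]
    rw [this]; abel
  have h2 : ∀ x : FormalSeries V, β x y - ext2 (fun r v w => B r v w) x y = 0 := by
    refine formalComplete.eq_zero_of_recursion _ fun x => ⟨tail x, ?_⟩
    conv_lhs => rw [eq_const_add x]
    rw [hl, sesq_add_left, hXl, sesq_X_smul_left, smul_sub, sub_eq_zero.1 (h1 (x 0, y))]
    abel
  exact sub_eq_zero.1 (h2 x)

end FormalSeries

/-! ## Existence of Hermitian deformations -/

/-- A finite tight frame for an `A`-valued inner product on a right `A`-module. -/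
def IsTightFrame [StarModule ℂ A] (h₀ : E →ₗ⋆[ℂ] E →ₗ[ℂ] A) {N : ℕ} (e : Fin N → E) : Prop :=
  ∀ s, ∑ i, op (h₀ (e i) s) • e i = s

/-- A pre-Hilbert module structure on a right `A`-module, without positivity. -/
structure IsHermitianForm [StarModule ℂ A] (h₀ : E →ₗ⋆[ℂ] E →ₗ[ℂ] A) : Prop where
  star_eq : ∀ s t, star (h₀ s t) = h₀ t s
  right : ∀ s t (a : A), h₀ s (op a • t) = h₀ s t * a
  definite : ∀ s, h₀ s s = 0 → s = 0

section Existence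

variable [StarModule ℂ A] {𝓔 : ModuleDeformation D E} {h₀ : E →ₗ⋆[ℂ] E →ₗ[ℂ] A}

/-- Expanding e_j in the frame shows Σ_l h₀(e_i, e_l) h₀(e_l, e_j) = h₀(e_i, e_j). The constant lift
of the Gram matrix is therefore idempotent modulo λ and can be corrected. -/
theorem exists_idempotent_matrix {N : ℕ} (hh : IsHermitianForm h₀) {e : Fin N → E}
    (he : IsTightFrame h₀ e) :
    ∃ P : Matrix (Fin N) (Fin N) D.Alg, P * P = P ∧
      ∀ i j, D.zeroth (P i j) = h₀ (e i) (e j) := by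
  set Q : Matrix (Fin N) (Fin N) D.Alg := fun i j => D.ofConst (h₀ (e i) (e j)) with hQ
  have h1 : ∀ i j, D.zeroth ((Q * Q - Q) i j) = 0 := by
    intro i j
    rw [Matrix.sub_apply, Matrix.mul_apply, map_sub, map_sum]
    simp only [map_mul, hQ, D.zeroth_ofConst]
    rw [sub_eq_zero]
    conv_rhs => rw [← he (e j)]
    simp only [map_sum, hh.right]
  choose R hR using fun i j => D.exists_eq_X_smul (h1 i j)
  have h2 : Q * Q - Q = (PowerSeries.X : ℂ⟦X⟧) • (Matrix.of R) := Matrix.ext fun i j => hR i j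
  obtain ⟨P, Y, hP, hPY⟩ := D.formalComplete.matrix.exists_idempotent (R := Matrix _ _ D.Alg)
    (fun y hy => Matrix.ext fun i j => D.X_smul_injective (by
      rw [Matrix.zero_apply, smul_zero]; exact congr_fun (congr_fun hy i) j)) h2
  refine ⟨P, hP, fun i j => ?_⟩
  rw [hPY, Matrix.add_apply, map_add, Matrix.smul_apply, D.zeroth_X_smul, add_zero]
  exact D.zeroth_ofConst _

theorem zeroth_mulVec {N : ℕ} {e : Fin N → E} (hh : IsHermitianForm h₀)
    {P : Matrix (Fin N) (Fin N) D.Alg}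
    (hP : ∀ i j, D.zeroth (P i j) = h₀ (e i) (e j)) (v : Fin N → D.Alg) (i : Fin N) :
    D.zeroth (P.mulVec v i) = h₀ (e i) (∑ j, op (D.zeroth (v j)) • e j) := by
  simp only [Matrix.mulVec, dotProduct, map_sum, map_mul, hP, hh.right]

/-- The `𝐀`-linear map `𝐀ᴺ → 𝐄` given by the constant sections `e i`. -/
noncomputable def frameMap (𝓔 : ModuleDeformation D E) {N : ℕ} (e : Fin N → E) :
    (Fin N → D.Alg) →ₗ[D.Algᵐᵒᵖ] 𝓔.Mod where
  toFun v := ∑ i, op (v i) • 𝓔.ofConst (e i)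
  map_add' v w := by
    rw [← Finset.sum_add_distrib]
    exact Finset.sum_congr rfl fun i _ => by rw [Pi.add_apply, op_add, add_smul]
  map_smul' a v := by
    rw [Finset.smul_sum]
    refine Finset.sum_congr rfl fun i _ => ?_
    rw [Pi.smul_apply, RingHom.id_apply, ← mul_smul]
    rfl

theorem frameMap_X_smul {N : ℕ} (e : Fin N → E) (v : Fin N → D.Alg) :
    frameMap 𝓔 e ((PowerSeries.X : ℂ⟦X⟧) • v) = (PowerSeries.X : ℂ⟦X⟧) • frameMap 𝓔 e v := by
  change ∑ i, op ((PowerSeries.X : ℂ⟦X⟧) • v i) • 𝓔.ofConst (e i) =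
    (PowerSeries.X : ℂ⟦X⟧) • ∑ i, op (v i) • 𝓔.ofConst (e i)
  rw [Finset.smul_sum]
  exact Finset.sum_congr rfl fun i _ => by rw [op_smul, smul_assoc]

theorem zeroth_frameMap {N : ℕ} (e : Fin N → E) (v : Fin N → D.Alg) :
    𝓔.zeroth (frameMap 𝓔 e v) = ∑ i, op (D.zeroth (v i)) • e i := by
  change 𝓔.zeroth (∑ i, op (v i) • 𝓔.ofConst (e i)) = _
  simp only [map_sum, 𝓔.zeroth_smul, 𝓔.zeroth_ofConst]

theorem mulVec_X_smul {N : ℕ} (P : Matrix (Fin N) (Fin N) D.Alg) (v : Fin N → D.Alg) :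
    P.mulVec ((PowerSeries.X : ℂ⟦X⟧) • v) = (PowerSeries.X : ℂ⟦X⟧) • P.mulVec v :=
  Matrix.mulVec_smul P _ v

/-- Modulo λ, a vector fixed by P is recovered from its image as h₀(e_i, Σ e_j v_j). So a fixed
vector in the kernel is divisible by λ, and the quotient is again fixed and in the kernel. -/
theorem frameMap_injective {N : ℕ} (hh : IsHermitianForm h₀) {e : Fin N → E}
    {P : Matrix (Fin N) (Fin N) D.Alg} (hP0 : ∀ i j, D.zeroth (P i j) = h₀ (e i) (e j))
    {v : Fin N → D.Alg} (hv : P.mulVec v = v) (hτ : frameMap 𝓔 e v = 0) : v = 0 := by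
  have hc : FormalComplete (Fin N → D.Alg) := FormalComplete.pi fun _ => D.formalComplete
  refine hc.eq_zero_of_mem {v | P.mulVec v = v ∧ frameMap 𝓔 e v = 0} ?_ ⟨hv, hτ⟩
  rintro v ⟨hv, hτ⟩
  have h0 : ∀ i, D.zeroth (v i) = 0 := fun i => by
    rw [← hv, zeroth_mulVec hh hP0, ← zeroth_frameMap (𝓔 := 𝓔), hτ, map_zero, map_zero]
  choose w hw using fun i => D.exists_eq_X_smul (h0 i)
  have hvw : v = (PowerSeries.X : ℂ⟦X⟧) • w := funext hw
  refine ⟨w, ⟨?_, ?_⟩, hvw⟩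
  · rw [hvw, mulVec_X_smul] at hv
    exact funext fun i => D.X_smul_injective (congr_fun hv i)
  · rw [hvw, frameMap_X_smul] at hτ
    exact 𝓔.X_smul_injective (by rw [hτ, smul_zero])

/-- Successive approximation: the frame coefficients of the zeroth order of x, projected by P, hit x
modulo λ, and the remainder is treated in the same way. -/
theorem frameMap_surjective {N : ℕ} (hh : IsHermitianForm h₀) {e : Fin N → E}
    (he : IsTightFrame h₀ e) {P : Matrix (Fin N) (Fin N) D.Alg} (hP : P * P = P)
    (hP0 : ∀ i j, D.zeroth (P i j) = h₀ (e i) (e j)) (x : 𝓔.Mod) :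
    ∃ v, P.mulVec v = v ∧ frameMap 𝓔 e v = x := by
  have hc : FormalComplete (Fin N → D.Alg) := FormalComplete.pi fun _ => D.formalComplete
  obtain ⟨S, hS⟩ := hc.exists_sum
  set f : 𝓔.Mod → Fin N → D.Alg := fun x i => D.ofConst (h₀ (e i) (𝓔.zeroth x)) with hf
  have h1 : ∀ x, 𝓔.zeroth (x - frameMap 𝓔 e (P.mulVec (f x))) = 0 := by
    intro x
    rw [map_sub, zeroth_frameMap, sub_eq_zero]
    simp only [zeroth_mulVec hh hP0, hf, D.zeroth_ofConst]
    rw [he, he]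
  choose g hg using fun x => 𝓔.exists_eq_X_smul (h1 x)
  -- V x = Σ λⁿ f(gⁿ x), where g x is the remainder divided by λ.
  set V : 𝓔.Mod → Fin N → D.Alg := fun x => S fun n => f (g^[n] x)
  have hV : ∀ x, V x = f x + (PowerSeries.X : ℂ⟦X⟧) • V (g x) := fun x => hS _
  have h2 : ∀ x, x - frameMap 𝓔 e (P.mulVec (V x)) = 0 := by
    refine 𝓔.formalComplete.eq_zero_of_recursion _ fun x => ⟨g x, ?_⟩
    rw [hV x, Matrix.mulVec_add, mulVec_X_smul, map_add, frameMap_X_smul, smul_sub, ← hg]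
    abel
  exact ⟨P.mulVec (V x), by rw [Matrix.mulVec_mulVec, hP], (sub_eq_zero.1 (h2 x)).symm⟩

/-- An isometric embedding of the module into a free module deforms. -/
theorem exists_deformed_embedding {N : ℕ} (𝓔 : ModuleDeformation D E) (hh : IsHermitianForm h₀)
    {e : Fin N → E} (he : IsTightFrame h₀ e) :
    ∃ j : 𝓔.Mod →ₗ[D.Algᵐᵒᵖ] (Fin N → D.Alg), ∀ x i,
      D.zeroth (j x i) = h₀ (e i) (𝓔.zeroth x) := by
  obtain ⟨P, hP, hP0⟩ := exists_idempotent_matrix (D := D) hh he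
  -- j inverts the frame map on the fixed vectors of P; its linearity follows from uniqueness of
  -- preimages.
  choose j hj1 hj2 using frameMap_surjective (𝓔 := 𝓔) hh he hP hP0
  have huniq : ∀ v w, P.mulVec v = v → P.mulVec w = w → frameMap 𝓔 e v = frameMap 𝓔 e w →
      v = w := fun v w hv hw h => sub_eq_zero.1 <| frameMap_injective (𝓔 := 𝓔) hh hP0
    (by rw [Matrix.mulVec_sub, hv, hw]) (by rw [map_sub, h, sub_self])
  refine ⟨⟨⟨j, fun x y => ?_⟩, fun a x => ?_⟩, fun x i => ?_⟩
  · exact huniq _ _ (hj1 _) (by rw [Matrix.mulVec_add, hj1, hj1])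
      (by rw [map_add, hj2, hj2, hj2])
  · exact huniq _ _ (hj1 _) (by rw [RingHom.id_apply, Matrix.mulVec_smul, hj1])
      (by rw [RingHom.id_apply, map_smul, hj2, hj2])
  · change D.zeroth (j x i) = _
    rw [← hj1 x, zeroth_mulVec hh hP0, ← zeroth_frameMap (𝓔 := 𝓔), hj2]

theorem FormalNonneg.zero : FormalNonneg 0 := ⟨fun n => by simp, Or.inl rfl⟩

theorem FormalNonneg.add {z w : ℂ⟦X⟧} (hz : FormalNonneg z) (hw : FormalNonneg w) :
    FormalNonneg (z + w) := by
  refine ⟨fun n => by rw [map_add, Complex.add_im, hz.1, hw.1, add_zero], ?_⟩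
  rcases hz.2 with rfl | ⟨n, hn, hn'⟩
  · rw [zero_add]; exact hw.2
  rcases hw.2 with rfl | ⟨m, hm, hm'⟩
  · rw [add_zero]; exact Or.inr ⟨n, hn, hn'⟩
  refine Or.inr ⟨min n m, ?_, fun l hl => ?_⟩
  · rw [map_add, Complex.add_re]
    rcases lt_trichotomy n m with h | h | h
    · rw [min_eq_left h.le, hm' n h, Complex.zero_re, add_zero]; exact hn
    · subst h; rw [min_self]; exact add_pos hn hm
    · rw [min_eq_right h.le, hn' m h, Complex.zero_re, zero_add]; exact hm
  · rw [map_add, hn' l (hl.trans_le (min_le_left _ _)), hm' l (hl.trans_le (min_le_right _ _)),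
      add_zero]

theorem FormalNonneg.sum {ι : Type*} (s : Finset ι) {z : ι → ℂ⟦X⟧}
    (h : ∀ i ∈ s, FormalNonneg (z i)) : FormalNonneg (∑ i ∈ s, z i) :=
  Finset.sum_induction _ _ (fun _ _ => FormalNonneg.add) FormalNonneg.zero h

theorem isPositiveElement_sum_star_mul {R : Type*} [Ring R] [StarRing R] [Algebra ℂ⟦X⟧ R]
    [StarModule ℂ⟦X⟧ R] {ι : Type*} (s : Finset ι) (a : ι → R) :
    IsPositiveElement (∑ i ∈ s, star (a i) * a i) := fun u hu => by
  rw [map_sum]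
  exact FormalNonneg.sum s fun i _ => hu (a i)

/-- Pull back the standard inner product Σ v_i* w_i of 𝐀ᴺ along the embedding j. Neither P
self-adjoint nor any correction of the result is needed: tightness makes the zeroth order exactly
h₀. -/
theorem exists_hermitianModuleDeformation {N : ℕ} (𝓔 : ModuleDeformation D E)
    (hh : IsHermitianForm h₀) {e : Fin N → E} (he : IsTightFrame h₀ e) :
    Nonempty (HermitianModuleDeformation 𝓔 h₀) := by
  obtain ⟨j, hj⟩ := exists_deformed_embedding 𝓔 hh he
  have hjz : ∀ (z : ℂ⟦X⟧) x i, j (z • x) i = z • j x i := fun z x i => by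
    rw [← 𝓔.smul_one_smul z x, map_smul, Pi.smul_apply, op_smul_eq_mul, mul_smul_comm, mul_one]
  set β : 𝓔.Mod → 𝓔.Mod → D.Alg := fun x y => ∑ i, star (j x i) * j y i with hβ
  have hl : ∀ x x' y, β (x + x') y = β x y + β x' y := fun x x' y => by
    simp only [hβ, map_add, Pi.add_apply, star_add, add_mul, Finset.sum_add_distrib]
  have hr : ∀ x y y', β x (y + y') = β x y + β x y' := fun x y y' => by
    simp only [hβ, map_add, Pi.add_apply, mul_add, Finset.sum_add_distrib]
  have hzl : ∀ (z : ℂ⟦X⟧) x y, β (z • x) y = star z • β x y := fun z x y => by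
    simp only [hβ, hjz, star_smul, smul_mul_assoc, Finset.smul_sum]
  have hzr : ∀ (z : ℂ⟦X⟧) x y, β x (z • y) = z • β x y := fun z x y => by
    simp only [hβ, hjz, mul_smul_comm, Finset.smul_sum]
  have hCstar : ∀ c : ℂ, star (PowerSeries.C c : ℂ⟦X⟧) = PowerSeries.C (star c) := fun c => by
    ext n; rw [coeff_star_formal, PowerSeries.coeff_C, PowerSeries.coeff_C]; split_ifs <;> simp
  have hCcoeff : ∀ (c : ℂ) (a : FormalSeries A) n, ((PowerSeries.C c : ℂ⟦X⟧) • a) n = c • a n :=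
    fun c a n => by
      rw [FormalSeries.smul_apply, Finset.sum_eq_single (0, n)]
      · simp
      · rintro ⟨k, l⟩ hp hne
        have hk : k ≠ 0 := by
          rintro rfl
          simp only [Finset.HasAntidiagonal.mem_antidiagonal, zero_add] at hp
          exact hne (by rw [hp])
        simp [PowerSeries.coeff_C, hk]
      · simp
  -- The h_n are read off from constant series; `FormalSeries.eq_ext2` then shows that they
  -- reproduce β.
  let B : ℕ → E →ₗ⋆[ℂ] E →ₗ[ℂ] A := fun n =>
    LinearMap.mk₂'ₛₗ (starRingEnd ℂ) (RingHom.id ℂ)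
      (fun s t => (β (𝓔.ofConst s) (𝓔.ofConst t) : FormalSeries A) n)
      (fun s s' t => by
        rw [show 𝓔.ofConst (s + s') = 𝓔.ofConst s + 𝓔.ofConst s' from
          FormalSeries.const_add s s', hl]; rfl)
      (fun c s t => by
        rw [show 𝓔.ofConst (c • s) = (PowerSeries.C c : ℂ⟦X⟧) • 𝓔.ofConst s from
          FormalSeries.const_smul c s, hzl, hCstar]; exact hCcoeff _ _ n)
      (fun s t t' => by
        rw [show 𝓔.ofConst (t + t') = 𝓔.ofConst t + 𝓔.ofConst t' from
          FormalSeries.const_add t t', hr]; rfl)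
      (fun c s t => by
        rw [show 𝓔.ofConst (c • t) = (PowerSeries.C c : ℂ⟦X⟧) • 𝓔.ofConst t from
          FormalSeries.const_smul c t, hzr]; exact hCcoeff _ _ n)
  have hB : ∀ x y, deformedForm 𝓔 B x y = β x y := fun x y =>
    (FormalSeries.eq_ext2 (U := A) (V := E) (W := E) B (β := β) hl hr
      (fun x y => (hzl _ x y).trans (by rw [X_star_formal]; rfl)) (fun x y => hzr _ x y)
      (fun _ _ _ => rfl) x y).symm
  have h0 : ∀ x y, D.zeroth (β x y) = h₀ (𝓔.zeroth x) (𝓔.zeroth y) := fun x y => by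
    simp only [hβ, map_sum, map_mul, D.zeroth_star, hj, hh.star_eq]
    conv_rhs => rw [← he (𝓔.zeroth y)]
    simp only [map_sum, hh.right]
  -- Definiteness of h₀ forces an isotropic x to be λy with λ²β(y, y) = 0, so y is isotropic too.
  have hdef : ∀ x : {x : 𝓔.Mod // β x x = 0}, (x : 𝓔.Mod) = 0 := by
    refine 𝓔.formalComplete.eq_zero_of_recursion _ fun ⟨x, hx⟩ => ?_
    have h1 : 𝓔.zeroth x = 0 := hh.definite _ (by rw [← h0, hx, map_zero])
    obtain ⟨y, rfl⟩ := 𝓔.exists_eq_X_smul h1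
    rw [hzl, hzr, X_star_formal] at hx
    refine ⟨⟨y, D.X_smul_injective (D.X_smul_injective ?_)⟩, rfl⟩
    rw [hx, smul_zero, smul_zero]
  refine ⟨⟨B, ?_, fun x y => ?_, fun x y a => ?_, fun x => ?_, fun x hx => ?_⟩⟩
  · refine LinearMap.ext fun s => LinearMap.ext fun t => ?_
    change D.zeroth (β (𝓔.ofConst s) (𝓔.ofConst t)) = _
    rw [h0, 𝓔.zeroth_ofConst, 𝓔.zeroth_ofConst]
  · rw [hB, hB]
    simp only [hβ, star_sum, star_mul, star_star]
  · rw [hB, hB]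
    simp only [hβ, map_smul, Pi.smul_apply, op_smul_eq_mul, Finset.sum_mul, mul_assoc]
  · rw [hB]
    exact isPositiveElement_sum_star_mul _ _
  · rw [hB] at hx
    exact hdef ⟨x, hx⟩

end Existence

end Deformations

/-! ## Equivalence bimodules from full inner products -/

section InnerProductModules

variable {R : Type*} [Ring R] [StarRing R] [Algebra ℂ⟦X⟧ R] [StarModule ℂ⟦X⟧ R]
  {Y : Type*} [AddCommGroup Y] [Module ℂ⟦X⟧ Y] [Module Rᵐᵒᵖ Y] [SMulCommClass Rᵐᵒᵖ ℂ⟦X⟧ Y]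
  [IsScalarTower ℂ⟦X⟧ Rᵐᵒᵖ Y]

/-- A non-degenerate Hermitian right linear `R`-valued inner product. -/
structure IsInnerProduct (H : Y → Y → R) : Prop where
  add_right : ∀ x y y', H x (y + y') = H x y + H x y'
  right : ∀ x y a, H x (op a • y) = H x y * a
  star_eq : ∀ x y, star (H x y) = H y x
  definite : ∀ x, H x x = 0 → x = 0

namespace IsInnerProduct

variable {H : Y → Y → R} (hH : IsInnerProduct H)
include hH

theorem add_left (x x' y : Y) : H (x + x') y = H x y + H x' y := by
  rw [← hH.star_eq, hH.add_right, star_add, hH.star_eq, hH.star_eq]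

theorem left (x y : Y) (a : R) : H (op a • x) y = star a * H x y := by
  rw [← hH.star_eq, hH.right, star_mul, hH.star_eq]

theorem smul_right (z : ℂ⟦X⟧) (x y : Y) : H x (z • y) = z • H x y := by
  have : z • y = op (z • (1 : R)) • y := by rw [op_smul, smul_assoc, op_one, one_smul]
  rw [this, hH.right, mul_smul_comm, mul_one]

theorem smul_left (z : ℂ⟦X⟧) (x y : Y) : H (z • x) y = star z • H x y := by
  rw [← hH.star_eq, hH.smul_right, star_smul, hH.star_eq]

theorem sum_right {ι : Type*} (s : Finset ι) (x : Y) (y : ι → Y) :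
    H x (∑ i ∈ s, y i) = ∑ i ∈ s, H x (y i) :=
  map_sum (AddMonoidHom.mk' (H x) (hH.add_right x)) y s

theorem sum_left {ι : Type*} (s : Finset ι) (x : ι → Y) (y : Y) :
    H (∑ i ∈ s, x i) y = ∑ i ∈ s, H (x i) y :=
  map_sum (AddMonoidHom.mk' (fun x => H x y) fun x x' => hH.add_left x x' y) x s

theorem ext {x x' : Y} (h : ∀ y, H x y = H x' y) : x = x' := by
  refine sub_eq_zero.1 (hH.definite _ ?_)
  have : H x (x - x') = H (x - x') (x - x') + H x' (x - x') := by
    rw [← hH.add_left, sub_add_cancel]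
  rw [← sub_eq_iff_eq_add.2 this, h, sub_self]

end IsInnerProduct

variable {H : Y → Y → R}

/-- The rank one operators of an inner product. -/
def IsRankOne (H : Y → Y → R) (Θ : Y → Y → Module.End Rᵐᵒᵖ Y) : Prop :=
  ∀ x y z, Θ x y z = op (H y z) • x

variable {Θ : Y → Y → Module.End Rᵐᵒᵖ Y}

theorem IsRankOne.apply_mul (hΘ : IsRankOne H Θ) (T : Module.End Rᵐᵒᵖ Y) (x y : Y) :
    Θ (T x) y = T * Θ x y :=
  LinearMap.ext fun z => by rw [Module.End.mul_apply, hΘ, hΘ, map_smul]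

theorem IsRankOne.smul (hΘ : IsRankOne H Θ) (z : ℂ⟦X⟧) (x y : Y) :
    Θ (z • x) y = z • Θ x y :=
  LinearMap.ext fun w => by rw [LinearMap.smul_apply, hΘ, hΘ, smul_comm]

theorem IsRankOne.adjoint (hΘ : IsRankOne H Θ) (hH : IsInnerProduct H) (a b x y : Y) :
    H x (Θ a b y) = H (Θ b a x) y := by
  rw [hΘ, hΘ, hH.right, hH.left, hH.star_eq]

/-- T = Σ Θ(T a_i, b_i), and the adjoint of a rank one operator swaps its entries. The families a
and b may differ because a symmetric decomposition is found only once adjoints exist. -/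
theorem IsRankOne.exists_adjoint (hΘ : IsRankOne H Θ) (hH : IsInnerProduct H) {N : ℕ}
    {a b : Fin N → Y} (hab : ∑ i, Θ (a i) (b i) = 1) (T : Module.End Rᵐᵒᵖ Y) :
    ∃ T' : Module.End Rᵐᵒᵖ Y, ∀ x y, H x (T y) = H (T' x) y := by
  refine ⟨∑ i, Θ (b i) (T (a i)), fun x y => ?_⟩
  have hT : T = ∑ i, Θ (T (a i)) (b i) := by
    simp only [hΘ.apply_mul, ← Finset.mul_sum, hab, mul_one]
  conv_lhs => rw [hT]
  simp only [LinearMap.sum_apply, hH.sum_right, hH.sum_left, hΘ.adjoint hH]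

/-- The adjoint as an involution. -/
noncomputable abbrev IsInnerProduct.starRing (hH : IsInnerProduct H)
    (hadj : ∀ T : Module.End Rᵐᵒᵖ Y, ∃ T' : Module.End Rᵐᵒᵖ Y, ∀ x y, H x (T y) = H (T' x) y) :
    StarRing (Module.End Rᵐᵒᵖ Y) :=
  have h (T : Module.End Rᵐᵒᵖ Y) (x y : Y) : H ((hadj T).choose x) y = H x (T y) :=
    ((hadj T).choose_spec x y).symm
  have h' (T : Module.End Rᵐᵒᵖ Y) (x y : Y) : H x ((hadj T).choose y) = H (T x) y := by
    rw [← hH.star_eq, h, hH.star_eq]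
  { star T := (hadj T).choose
    star_involutive T := LinearMap.ext fun x => hH.ext fun y => by rw [h, h']
    star_mul S T := LinearMap.ext fun x => hH.ext fun y => by
      rw [h, Module.End.mul_apply, Module.End.mul_apply, h, h]
    star_add S T := LinearMap.ext fun x => hH.ext fun y => by
      rw [h, LinearMap.add_apply, LinearMap.add_apply, hH.add_left, hH.add_right, h, h] }

theorem IsInnerProduct.exists_starRing (hH : IsInnerProduct H)
    (hadj : ∀ T : Module.End Rᵐᵒᵖ Y, ∃ T' : Module.End Rᵐᵒᵖ Y, ∀ x y, H x (T y) = H (T' x) y) :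
    ∃ (_ : StarRing (Module.End Rᵐᵒᵖ Y)) (_ : StarModule ℂ⟦X⟧ (Module.End Rᵐᵒᵖ Y)),
      ∀ (T : Module.End Rᵐᵒᵖ Y) x y, H x (T y) = H (star T x) y := by
  let _ := hH.starRing hadj
  have h : ∀ (T : Module.End Rᵐᵒᵖ Y) x y, H x (T y) = H (star T x) y :=
    fun T => (hadj T).choose_spec
  refine ⟨inferInstance, ⟨fun z T => LinearMap.ext fun x => hH.ext fun y => ?_⟩, h⟩
  rw [← h, LinearMap.smul_apply, LinearMap.smul_apply, hH.smul_right, hH.smul_left, star_star, h]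

/-- The common shape of the inner products in (P) and (Q): finite sums of pullbacks of a positive
one. -/
theorem PreHilbert.exists_sesquilinear {Q H : Type*} [AddCommGroup H] [Module ℂ⟦X⟧ H]
    [AddCommGroup Q] [Module ℂ⟦X⟧ Q] (ip : PreHilbert H) {N : ℕ} (Φ : Fin N → Q →ₗ[ℂ⟦X⟧] H) :
    ∃ S : Q →ₗ⋆[ℂ⟦X⟧] Q →ₗ[ℂ⟦X⟧] ℂ⟦X⟧,
      (∀ s t, S s t = ∑ k, ip.inner (Φ k s) (Φ k t)) ∧ ∀ t, FormalNonneg (S t t) := by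
  refine ⟨LinearMap.mk₂'ₛₗ _ _ (fun s t => ∑ k, ip.inner (Φ k s) (Φ k t)) ?_ ?_ ?_ ?_,
    fun _ _ => rfl, fun t => FormalNonneg.sum _ fun k _ => ip.nonneg _⟩
  · intro s s' t; simp [Finset.sum_add_distrib]
  · intro c s t; simp [Finset.mul_sum]
  · intro s t t'; simp [Finset.sum_add_distrib]
  · intro c s t; simp [Finset.mul_sum]

universe wA wE wH

/-- The frame gives H(x, y) = Σ H(e_k, x)* H(e_k, y), so the form is Σ ⟨Φ_k ·, Φ_k ·⟩ with Φ_k(x ⊗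
ψ) = ρ(H(e_k, x))ψ, which respects the balancing relations. -/
theorem IsInnerProduct.propertyP {R : Type wA} [Ring R] [StarRing R] [Algebra ℂ⟦X⟧ R]
    [StarModule ℂ⟦X⟧ R] {Y : Type wE} [AddCommGroup Y] [Module ℂ⟦X⟧ Y] [Module Rᵐᵒᵖ Y]
    [SMulCommClass Rᵐᵒᵖ ℂ⟦X⟧ Y] [IsScalarTower ℂ⟦X⟧ Rᵐᵒᵖ Y] {H : Y → Y → R}
    (hH : IsInnerProduct H) {N : ℕ} {e : Fin N → Y}
    (he : ∀ x, ∑ i, op (H (e i) x) • e i = x) : PropertyP.{wA, wE, wH} H := by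
  intro K _ _ ip ρ
  let Φ₀ : Fin N → (Y ⊗[ℂ⟦X⟧] K) →ₗ[ℂ⟦X⟧] K := fun k => TensorProduct.lift
    (LinearMap.mk₂ ℂ⟦X⟧ (fun x ψ => ρ.toHom (H (e k) x) ψ)
      (fun x x' ψ => by rw [hH.add_right, map_add, LinearMap.add_apply])
      (fun c x ψ => by rw [hH.smul_right, map_smul, LinearMap.smul_apply])
      (fun x ψ ψ' => map_add _ _ _) (fun c x ψ => map_smul _ _ _))
  have hΦ : ∀ k, balancingRight R Y ρ ≤ LinearMap.ker (Φ₀ k) := fun k => by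
    refine Submodule.span_le.2 ?_
    rintro _ ⟨x, a, ψ, rfl⟩
    simp [Φ₀, hH.right]
  obtain ⟨S, hS, hS'⟩ := ip.exists_sesquilinear fun k => (balancingRight R Y ρ).liftQ _ (hΦ k)
  refine ⟨S, fun x y ψ φ => ?_, hS'⟩
  rw [hS]
  simp only [Submodule.liftQ_apply, Φ₀, TensorProduct.lift.tmul, LinearMap.mk₂_apply, ρ.adjoint,
    hH.star_eq]
  conv_rhs => rw [← he y]
  simp only [hH.sum_right, hH.right, map_sum, map_mul, LinearMap.sum_apply, Module.End.mul_apply]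

/-- Mirror image of (P), with Φ_k(ψ ⊗ x) = ψ · ρ(Θ(x, e_k)). Here e is not a frame: the
factorization of Θ comes from a family with Σ H(e_k, e_k) = 1. -/
theorem IsRankOne.propertyQ {R : Type*} [Ring R] [StarRing R] [Algebra ℂ⟦X⟧ R]
    [StarModule ℂ⟦X⟧ R] {Y : Type wE} [AddCommGroup Y] [Module ℂ⟦X⟧ Y] [Module Rᵐᵒᵖ Y]
    [SMulCommClass Rᵐᵒᵖ ℂ⟦X⟧ Y] [IsScalarTower ℂ⟦X⟧ Rᵐᵒᵖ Y] {H : Y → Y → R}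
    {Θ : Y → Y → Module.End Rᵐᵒᵖ Y} [StarRing (Module.End Rᵐᵒᵖ Y)]
    [StarModule ℂ⟦X⟧ (Module.End Rᵐᵒᵖ Y)] (hΘ : IsRankOne H Θ)
    (hadd : ∀ x x' y, Θ (x + x') y = Θ x y + Θ x' y) (hstar : ∀ x y, star (Θ x y) = Θ y x)
    {N : ℕ} {e : Fin N → Y} (he : ∀ x y, ∑ i, Θ x (e i) * Θ (e i) y = Θ x y) :
    PropertyQ.{wE, wE, wH} Θ := by
  intro K _ _ ip ρ
  let Φ₀ : Fin N → (K ⊗[ℂ⟦X⟧] Y) →ₗ[ℂ⟦X⟧] K := fun k => TensorProduct.lift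
    (LinearMap.mk₂ ℂ⟦X⟧ (fun ψ x => ρ.toHom (op (Θ x (e k))) ψ)
      (fun ψ ψ' x => map_add _ _ _) (fun c ψ x => map_smul _ _ _)
      (fun ψ x x' => by rw [hadd, op_add, map_add, LinearMap.add_apply])
      (fun c ψ x => by rw [hΘ.smul, op_smul, map_smul, LinearMap.smul_apply]))
  have hΦ : ∀ k, balancingLeft (Module.End Rᵐᵒᵖ Y) Y ρ ≤ LinearMap.ker (Φ₀ k) := fun k => by
    refine Submodule.span_le.2 ?_
    rintro _ ⟨ψ, b, x, rfl⟩
    simp [Φ₀, hΘ.apply_mul]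
  obtain ⟨S, hS, hS'⟩ :=
    ip.exists_sesquilinear fun k => (balancingLeft (Module.End Rᵐᵒᵖ Y) Y ρ).liftQ _ (hΦ k)
  refine ⟨S, fun x y ψ φ => ?_, hS'⟩
  rw [hS]
  simp only [Submodule.liftQ_apply, Φ₀, TensorProduct.lift.tmul, LinearMap.mk₂_apply, ρ.adjoint,
    ← op_star, hstar]
  rw [← he x y]
  simp only [Finset.op_sum, map_sum, op_mul, map_mul, LinearMap.sum_apply, Module.End.mul_apply]

/-- The frame e yields fullness of Θ and (P); the family u yields fullness of H, positivity of Θ and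
(Q). -/
theorem IsRankOne.isNondegenerateEquivalenceBimodule {R : Type wA} [Ring R] [StarRing R]
    [Algebra ℂ⟦X⟧ R] [StarModule ℂ⟦X⟧ R] {Y : Type wE} [AddCommGroup Y] [Module ℂ⟦X⟧ Y]
    [Module Rᵐᵒᵖ Y] [SMulCommClass Rᵐᵒᵖ ℂ⟦X⟧ Y] [IsScalarTower ℂ⟦X⟧ Rᵐᵒᵖ Y] {H : Y → Y → R}
    {Θ : Y → Y → Module.End Rᵐᵒᵖ Y} [StarRing (Module.End Rᵐᵒᵖ Y)]
    [StarModule ℂ⟦X⟧ (Module.End Rᵐᵒᵖ Y)] (hΘ : IsRankOne H Θ) (hH : IsInnerProduct H)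
    (hpos : ∀ x, IsPositiveElement (H x x))
    (hadj : ∀ (T : Module.End Rᵐᵒᵖ Y) x y, H x (T y) = H (star T x) y)
    {N : ℕ} {e : Fin N → Y} (he : ∑ i, Θ (e i) (e i) = 1)
    {N' : ℕ} {u : Fin N' → Y} (hu : ∑ i, H (u i) (u i) = 1) :
    IsNondegenerateEquivalenceBimodule.{wA, wE, wE, wH} H Θ := by
  have hstar : ∀ x y, star (Θ x y) = Θ y x := fun x y => LinearMap.ext fun z => hH.ext fun w => by
    rw [← hadj, hΘ.adjoint hH]
  have hadd : ∀ x x' y, Θ (x + x') y = Θ x y + Θ x' y := fun x x' y => LinearMap.ext fun z => by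
    rw [LinearMap.add_apply, hΘ, hΘ, hΘ, smul_add]
  have hright : ∀ (a : R) (x y : Y), Θ x (op a • y) = Θ (op (star a) • x) y := fun a x y =>
    LinearMap.ext fun z => by rw [hΘ, hΘ, hH.left, op_mul, mul_smul]
  have hex : ∀ x, ∑ i, op (H (e i) x) • e i = x := fun x => by
    simpa only [LinearMap.sum_apply, hΘ _ _ _, Module.End.one_apply] using LinearMap.congr_fun he x
  -- Each summand is Θ(x · H(u_i, u_i), y), and the H(u_i, u_i) add up to 1.
  have hux : ∀ x y, ∑ i, Θ x (u i) * Θ (u i) y = Θ x y := fun x y => by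
    simp only [← hΘ.apply_mul, hΘ _ _ _]
    refine LinearMap.ext fun z => ?_
    simp only [LinearMap.sum_apply, hΘ _ _ _, ← mul_smul, ← op_mul]
    rw [← Finset.sum_smul, ← Finset.op_sum, ← Finset.sum_mul, hu, one_mul]
  have hzr : ∀ (z : ℂ⟦X⟧) (a : R) (x : Y), op (z • a) • x = z • op a • x := fun z a x => by
    rw [op_smul, smul_assoc]
  exact
  { smul_smul_comm := fun b a x => map_smul b _ _
    smul_left := fun z b x => rfl
    smul_right := hzr
    h_add := hH.add_right
    h_smul := hH.smul_right
    h_right := hH.right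
    h_star := hH.star_eq
    h_pos := hpos
    h_full := by
      refine eq_top_iff.2 fun a _ => ?_
      rw [← one_mul a, ← hu, Finset.sum_mul]
      exact Submodule.sum_mem _ fun i _ =>
        Submodule.subset_span ⟨u i, op a • u i, (hH.right _ _ _).symm⟩
    Θ_add := hadd
    Θ_smul := hΘ.smul
    Θ_left := hΘ.apply_mul
    Θ_star := hstar
    Θ_pos := fun x => by
      rw [← hux x x]
      simp only [← hstar _ x]
      exact isPositiveElement_sum_star_mul Finset.univ fun i => Θ (u i) x
    Θ_full := by
      refine eq_top_iff.2 fun T _ => ?_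
      rw [← mul_one T, ← he, Finset.mul_sum]
      exact Submodule.sum_mem _ fun i _ =>
        Submodule.subset_span ⟨T (e i), e i, (hΘ.apply_mul _ _ _).symm⟩
    h_adjoint := hadj
    Θ_adjoint := hright
    compat := hΘ
    propP := hH.propertyP hex
    propQ := hΘ.propertyQ hadd hstar hux
    left_nondegenerate := eq_top_iff.2 fun x _ => Submodule.subset_span ⟨1, x, rfl⟩
    right_nondegenerate := eq_top_iff.2 fun x _ =>
      Submodule.subset_span ⟨1, x, by rw [op_one, one_smul]⟩ }

end InnerProductModules

/-! ### Deforming frames and decompositions of unity -/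

section HermitianDeformations

universe u v

variable {A : Type u} [Ring A] [Algebra ℂ A] [StarRing A] [StarModule ℂ A]
  {E : Type v} [AddCommGroup E] [Module ℂ E] [Module Aᵐᵒᵖ E] {D : HermitianDeformation A}
  {𝓔 : ModuleDeformation D E} {h₀ : E →ₗ⋆[ℂ] E →ₗ[ℂ] A}

theorem ModuleDeformation.end_X_smul_injective {S T : Module.End D.Algᵐᵒᵖ 𝓔.Mod}
    (h : (PowerSeries.X : ℂ⟦X⟧) • S = (PowerSeries.X : ℂ⟦X⟧) • T) : S = T :=
  LinearMap.ext fun x => 𝓔.X_smul_injective (LinearMap.congr_fun h x)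

/-- T − 1 has all its values in λ𝐄, and injectivity of λ makes the pointwise quotients linear again.
-/
theorem ModuleDeformation.exists_eq_one_add (T : Module.End D.Algᵐᵒᵖ 𝓔.Mod)
    (hT : ∀ x, 𝓔.zeroth (T x) = 𝓔.zeroth x) :
    ∃ N : Module.End D.Algᵐᵒᵖ 𝓔.Mod, T = 1 + (PowerSeries.X : ℂ⟦X⟧) • N := by
  have h1 : ∀ x, 𝓔.zeroth ((T - 1) x) = 0 := fun x => by
    rw [LinearMap.sub_apply, map_sub, hT, Module.End.one_apply, sub_self]
  choose N hN using fun x => 𝓔.exists_eq_X_smul (h1 x)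
  refine ⟨⟨⟨N, fun x y => 𝓔.X_smul_injective ?_⟩, fun a x => 𝓔.X_smul_injective ?_⟩, ?_⟩
  · rw [← hN, smul_add, ← hN, ← hN, map_add]
  · rw [RingHom.id_apply, ← hN, ← smul_comm, ← hN, map_smul]
  · rw [← sub_eq_iff_eq_add']
    exact LinearMap.ext hN

namespace HermitianModuleDeformation

variable (h : HermitianModuleDeformation 𝓔 h₀)

theorem isInnerProduct : IsInnerProduct h.form :=
  ⟨h.form_add, h.right_linear, h.conj_symm, h.definite⟩

theorem isRankOne_theta : IsRankOne h.form h.theta := fun _ _ _ => rfl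

theorem zeroth_form (x y : 𝓔.Mod) :
    D.zeroth (h.form x y) = h₀ (𝓔.zeroth x) (𝓔.zeroth y) := by
  change FormalSeries.ext2 (fun r v w => h.coeff r v w) _ _ 0 = _
  simp [FormalSeries.ext2, h.coeff_zero]
  rfl

theorem zeroth_theta (x y z : 𝓔.Mod) :
    𝓔.zeroth (h.theta x y z) = op (h₀ (𝓔.zeroth y) (𝓔.zeroth z)) • 𝓔.zeroth x := by
  rw [h.isRankOne_theta, 𝓔.zeroth_smul, h.zeroth_form]

/-- The frame operator of a classical tight frame has an inverse square root. -/
theorem exists_inv_sqrt_frame {N : ℕ} {e : Fin N → E} (he : IsTightFrame h₀ e) :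
    ∃ S : Module.End D.Algᵐᵒᵖ 𝓔.Mod,
      S * S * ∑ i, h.theta (𝓔.ofConst (e i)) (𝓔.ofConst (e i)) = 1 ∧
      Commute (∑ i, h.theta (𝓔.ofConst (e i)) (𝓔.ofConst (e i))) S ∧
      ∀ [StarRing (Module.End D.Algᵐᵒᵖ 𝓔.Mod)] [StarModule ℂ⟦X⟧ (Module.End D.Algᵐᵒᵖ 𝓔.Mod)],
        (star (∑ i, h.theta (𝓔.ofConst (e i)) (𝓔.ofConst (e i))) =
          ∑ i, h.theta (𝓔.ofConst (e i)) (𝓔.ofConst (e i))) → star S = S := by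
  obtain ⟨N, hN⟩ := 𝓔.exists_eq_one_add
    (∑ i, h.theta (𝓔.ofConst (e i)) (𝓔.ofConst (e i))) fun x => by
      simp only [LinearMap.sum_apply, map_sum, h.zeroth_theta, 𝓔.zeroth_ofConst]
      exact he _
  obtain ⟨S, -, -, hS, hc, hs⟩ := (𝓔.formalComplete.moduleEnd (R := D.Algᵐᵒᵖ)).exists_inv_sqrt N
  rw [hN]
  refine ⟨S, hS, hc _ ((Commute.one_left N).add_left ((Commute.refl N).smul_left _)), ?_⟩
  intro _ _ hT
  refine hs (𝓔.end_X_smul_injective ?_)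
  rw [star_add, star_one, star_smul, X_star_formal] at hT
  exact add_left_cancel hT

/-- The sum a of the deformed 𝐡(w_i, w_i) is Hermitian and 1 modulo λ. Taking u_i = w_i • a^(-1/2)
turns the sum into a^(-1/2) ⋆ a ⋆ a^(-1/2) = 1. -/
theorem exists_unit {N : ℕ} {w : Fin N → E} (hw : ∑ i, h₀ (w i) (w i) = 1) :
    ∃ u : Fin N → 𝓔.Mod, ∑ i, h.form (u i) (u i) = 1 := by
  set a := ∑ i, h.form (𝓔.ofConst (w i)) (𝓔.ofConst (w i)) with ha
  obtain ⟨N, hN⟩ := D.exists_eq_X_smul (a := a - 1) (by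
    rw [map_sub, map_one, ha, map_sum]
    simp only [h.zeroth_form, 𝓔.zeroth_ofConst, hw, sub_self])
  rw [sub_eq_iff_eq_add'] at hN
  obtain ⟨S, -, -, hS, hc, hs⟩ := D.formalComplete.exists_inv_sqrt N
  have hstar : star S = S := by
    refine hs (D.X_smul_injective ?_)
    have : star a = a := by
      rw [ha, star_sum]
      exact Finset.sum_congr rfl fun i _ => h.isInnerProduct.star_eq _ _
    rw [hN, star_add, star_one, star_smul, X_star_formal] at this
    exact add_left_cancel this
  have hac : Commute a S := by
    rw [hN]
    exact hc _ ((Commute.one_left N).add_left ((Commute.refl N).smul_left _))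
  refine ⟨fun i => op S • 𝓔.ofConst (w i), ?_⟩
  simp only [h.isInnerProduct.right, h.isInnerProduct.left, ← Finset.sum_mul, ← Finset.mul_sum]
  rw [← ha, hstar, mul_assoc, hac.eq, ← mul_assoc, hN, hS]

theorem exists_isNondegenerateEquivalenceBimodule {N : ℕ} {e : Fin N → E}
    (he : IsTightFrame h₀ e) {N' : ℕ} {w : Fin N' → E} (hw : ∑ i, h₀ (w i) (w i) = 1) :
    ∃ (_ : StarRing (Module.End D.Algᵐᵒᵖ 𝓔.Mod))
      (_ : StarModule ℂ⟦X⟧ (Module.End D.Algᵐᵒᵖ 𝓔.Mod)),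
      (∀ (T : Module.End D.Algᵐᵒᵖ 𝓔.Mod) (x y : 𝓔.Mod),
        h.form x (T y) = h.form (star T x) y) ∧
      IsNondegenerateEquivalenceBimodule h.form h.theta := by
  have hH := h.isInnerProduct
  have hΘ := h.isRankOne_theta
  obtain ⟨S, hS, hc, hs⟩ := h.exists_inv_sqrt_frame he
  set T := ∑ i, h.theta (𝓔.ofConst (e i)) (𝓔.ofConst (e i)) with hT
  -- Self-adjointness of S makes sense only once adjoints exist, so they come from the asymmetric
  -- decomposition Σ Θ(S²e_i, e_i) = S²T = 1.
  obtain ⟨s₁, s₂, hadj⟩ := hH.exists_starRing (hΘ.exists_adjoint hH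
    (a := fun i => (S * S) (𝓔.ofConst (e i))) (b := fun i => 𝓔.ofConst (e i)) (by
      simp only [hΘ.apply_mul, ← Finset.mul_sum]; exact hS))
  have hTs : star T = T := by
    rw [hT, star_sum]
    refine Finset.sum_congr rfl fun i _ => LinearMap.ext fun x => hH.ext fun y => ?_
    rw [← hadj, hΘ.adjoint hH]
  obtain ⟨u, hu⟩ := h.exists_unit hw
  refine ⟨s₁, s₂, hadj, hΘ.isNondegenerateEquivalenceBimodule hH h.nonneg hadj
    (e := fun i => S (𝓔.ofConst (e i))) ?_ hu⟩
  -- With S self-adjoint, the frame operator of the S e_i is STS, which is 1 because S commutes with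
  -- T.
  have h1 : ∀ x y, h.theta (S x) (S y) = S * h.theta x y * S := fun x y => LinearMap.ext fun z => by
    rw [hΘ, Module.End.mul_apply, Module.End.mul_apply, hΘ, map_smul, hadj, hs hTs]
  simp only [h1, ← Finset.sum_mul, ← Finset.mul_sum]
  rw [← hT, mul_assoc, hc.eq, ← mul_assoc, hS]

end HermitianModuleDeformation

end HermitianDeformations

/-! ## Smooth sections -/

section Sections

open Set Filter Topology Bundle

variable {EM : Type*} [NormedAddCommGroup EM] [NormedSpace ℝ EM] [FiniteDimensional ℝ EM]
  {HM : Type*} [TopologicalSpace HM] {I : ModelWithCorners ℝ EM HM}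
  {M : Type*} [TopologicalSpace M] [ChartedSpace HM M] [IsManifold I ∞ M]
  [T2Space M] [SigmaCompactSpace M]
  {F : Type*} [NormedAddCommGroup F] [NormedSpace ℂ F] [FiniteDimensional ℂ F]
  {E : M → Type*} [∀ x, AddCommGroup (E x)] [∀ x, Module ℂ (E x)]
  [TopologicalSpace (Bundle.TotalSpace F E)] [∀ x, TopologicalSpace (E x)] [FiberBundle F E]
  [VectorBundle ℂ F E] [VectorBundle ℝ F E] [ContMDiffVectorBundle ∞ F E I]

variable (I F) in
/-- Smoothness of a section on a set. -/
def SmoothSectionOn (s : ∀ x, E x) (U : Set M) : Prop :=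
  ContMDiffOn I (I.prod 𝓘(ℝ, F)) ∞ (fun x => TotalSpace.mk' F x (s x)) U

theorem SmoothSectionOn.exists_global {s : ∀ x, E x} {U : Set M} (hs : SmoothSectionOn I F s U)
    (hU : IsOpen U) {x₀ : M} (hx₀ : x₀ ∈ U) :
    ∃ t : SmoothSections I F E, ∀ᶠ x in 𝓝 x₀, t.1 x = s x := by
  obtain ⟨ψ, -, hψ⟩ := (SmoothBumpFunction.nhds_basis_tsupport (I := I) x₀).mem_iff.1
    (hU.mem_nhds hx₀)
  refine ⟨⟨(ψ : M → ℝ) • s,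
    ContMDiffOn.smul_section_of_tsupport ψ.contMDiff.contMDiffOn hU hψ hs⟩, ?_⟩
  filter_upwards [ψ.eventuallyEq_one] with x hx
  change ψ x • s x = s x
  rw [hx, Pi.one_apply, one_smul]

theorem SmoothSectionOn.complex_smul {f : M → ℂ} {s : ∀ x, E x} {U : Set M}
    (hs : SmoothSectionOn I F s U) (hf : ContMDiffOn I 𝓘(ℝ, ℂ) ∞ f U) (hU : IsOpen U) :
    SmoothSectionOn I F (fun x => f x • s x) U := by
  intro x₀ hx₀
  refine ContMDiffAt.contMDiffWithinAt ?_
  have hs' := (Bundle.contMDiffAt_section x₀).1 ((hs x₀ hx₀).contMDiffAt (hU.mem_nhds hx₀))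
  rw [Bundle.contMDiffAt_section]
  have h : ContDiff ℝ ∞ (fun p : ℂ × F => p.1 • p.2) := contDiff_smul
  refine ((h.contMDiff.contMDiffAt (x := (f x₀, _))).comp x₀
    (((hf x₀ hx₀).contMDiffAt (hU.mem_nhds hx₀)).prodMk_space hs')).congr_of_eventuallyEq ?_
  have hmem := (trivializationAt F E x₀).open_baseSet.mem_nhds
    (mem_baseSet_trivializationAt F E x₀)
  filter_upwards [hmem] with x hx
  exact ((trivializationAt F E x₀).linear ℂ hx).2 _ _

/-- Smoothness of the metric is given for global sections only, so local sections are first replaced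
by global ones with the same germ. -/
theorem HermitianMetric.contMDiffOn (g : HermitianMetric I F E) {s t : ∀ x, E x} {U : Set M}
    (hs : SmoothSectionOn I F s U) (ht : SmoothSectionOn I F t U) (hU : IsOpen U) :
    ContMDiffOn I 𝓘(ℝ, ℂ) ∞ (fun x => g.inner x (s x) (t x)) U := by
  intro x₀ hx₀
  obtain ⟨s', hs'⟩ := hs.exists_global hU hx₀
  obtain ⟨t', ht'⟩ := ht.exists_global hU hx₀
  refine ((g.smooth s' t') x₀ |>.congr_of_eventuallyEq ?_).contMDiffWithinAt
  filter_upwards [hs', ht'] with x h1 h2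
  rw [h1, h2]

/-- A finite family of sections spans the fibre over `x`. -/
def SpansAt {ι : Type*} (s : ι → SmoothSections I F E) (x : M) : Prop :=
  Submodule.span ℂ (range fun i => (s i).1 x) = ⊤

theorem exists_spansAt_nhds (x₀ : M) :
    ∃ (n : ℕ) (s : Fin n → SmoothSections I F E), ∀ᶠ x in 𝓝 x₀, SpansAt s x := by
  let b := Module.finBasis ℝ F
  let e := trivializationAt F E x₀
  have hx₀ : x₀ ∈ e.baseSet := mem_baseSet_trivializationAt F E x₀
  have hfr := e.isLocalFrameOn_localFrame_baseSet I ∞ b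
  choose s hs using fun i => SmoothSectionOn.exists_global (hfr.contMDiffOn i) e.open_baseSet hx₀
  refine ⟨_, s, ?_⟩
  filter_upwards [eventually_all.2 hs, e.open_baseSet.mem_nhds hx₀] with x hx hxe
  refine eq_top_iff.2 fun v _ => ?_
  have hv := hfr.generating hxe (Submodule.mem_top (x := v))
  -- The local frame generates the fibre over ℝ, hence a fortiori over ℂ.
  have := Submodule.span_le_restrictScalars ℝ ℂ (range fun i => (s i).1 x)
  refine this ?_
  simp only [hx]
  exact hv

theorem exists_spansAt_of_isCompact {K : Set M} (hK : IsCompact K) :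
    ∃ (n : ℕ) (s : Fin n → SmoothSections I F E), ∀ x ∈ K, SpansAt s x := by
  refine hK.induction_on (p := fun K => ∃ (n : ℕ) (s : Fin n → SmoothSections I F E),
    ∀ x ∈ K, SpansAt s x) ⟨0, Fin.elim0, by simp⟩ ?_ ?_ ?_
  · rintro K K' hKK' ⟨n, s, hs⟩
    exact ⟨n, s, fun x hx => hs x (hKK' hx)⟩
  · rintro K K' ⟨n, s, hs⟩ ⟨n', s', hs'⟩
    refine ⟨n + n', Fin.append s s', ?_⟩
    rintro x (hx | hx)
    · refine eq_top_iff.2 ((hs x hx).symm.le.trans (Submodule.span_mono ?_))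
      rintro _ ⟨i, rfl⟩
      exact ⟨Fin.castAdd n' i, by simp⟩
    · refine eq_top_iff.2 ((hs' x hx).symm.le.trans (Submodule.span_mono ?_))
      rintro _ ⟨i, rfl⟩
      exact ⟨Fin.natAdd n i, by simp⟩
  · intro x _
    obtain ⟨n, s, hs⟩ := exists_spansAt_nhds (I := I) (F := F) (E := E) x
    exact ⟨_, mem_nhdsWithin_of_mem_nhds hs, n, s, fun y hy => hy⟩

/-! ## Reducing the number of spanning sections -/

/-- The parameters `a` for which `s i + a i • s r` fail to span over `x`. -/
def badParameters {r : ℕ} (s : Fin (r + 1) → SmoothSections I F E) (x : M) :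
    Set (Fin r → ℂ) :=
  {a | ¬ SpansAt (fun i : Fin r => s i.castSucc + a i • s (Fin.last r)) x}

/-- Failure to span gives a nonzero φ killing every s_i + a_i s_r. If φ(s_r) were 0, φ would kill
all the s_i; so it can be scaled to φ(s_r) = 1, whence a_i = −φ(s_i). -/
theorem exists_functional_of_mem_badParameters {r : ℕ} {s : Fin (r + 1) → SmoothSections I F E}
    {x : M} (hs : SpansAt s x) {a : Fin r → ℂ} (ha : a ∈ badParameters s x) :
    ∃ φ : E x →ₗ[ℂ] ℂ, ∀ i, a i = -φ ((s i.castSucc).1 x) := by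
  obtain ⟨φ, hφ, hφs⟩ := Submodule.exists_dual_map_eq_bot_of_lt_top (lt_top_iff_ne_top.2 ha)
    inferInstance
  have h1 : ∀ i : Fin r, φ ((s i.castSucc).1 x) + a i * φ ((s (Fin.last r)).1 x) = 0 := fun i => by
    have : φ ((s i.castSucc).1 x + a i • (s (Fin.last r)).1 x) ∈ (⊥ : Submodule ℂ ℂ) := by
      rw [← hφs]
      exact Submodule.mem_map_of_mem (Submodule.subset_span ⟨i, rfl⟩)
    simpa using this
  have h2 : φ ((s (Fin.last r)).1 x) ≠ 0 := fun h0 => by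
    refine hφ (LinearMap.ext_on_range (v := fun i => (s i).1 x) hs fun i => ?_)
    refine Fin.lastCases ?_ (fun i => ?_) i
    · simpa using h0
    · have := h1 i
      rw [h0, mul_zero, add_zero] at this
      simpa using this
  refine ⟨(φ ((s (Fin.last r)).1 x))⁻¹ • φ, fun i => ?_⟩
  have := h1 i
  rw [LinearMap.smul_apply, smul_eq_mul]
  field_simp
  linear_combination this

/-- The bad parameters lie in the image of the dual bundle under (x, φ) ↦ (−φ(s_i(x)))_i. In a chart
this is a C¹ map, which does not raise Hausdorff dimension. -/
theorem exists_nhds_dimH_badParameters_le {r : ℕ} (s : Fin (r + 1) → SmoothSections I F E)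
    (x₀ : M) : ∃ V ∈ 𝓝 x₀, dimH {a | ∃ x ∈ V, SpansAt s x ∧ a ∈ badParameters s x} ≤
      Module.finrank ℝ (EM × (F →L[ℂ] ℂ)) := by
  let e := trivializationAt F E x₀
  let φ := extChartAt I x₀
  have hx₀ : x₀ ∈ e.baseSet := mem_baseSet_trivializationAt F E x₀
  have hpre : φ.target ∩ φ.symm ⁻¹' e.baseSet ∈ 𝓝[range I] (φ x₀) :=
    inter_mem (extChartAt_target_mem_nhdsWithin x₀)
      (mem_nhdsWithin_of_mem_nhds
        (extChartAt_preimage_mem_nhds (e.open_baseSet.mem_nhds hx₀)))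
  obtain ⟨ε, hε, hball⟩ := Metric.mem_nhdsWithin_iff.1 hpre
  -- The dimension estimate for C¹ images is applied on a convex set.
  set B : Set EM := Metric.ball (φ x₀) ε ∩ range I with hB
  have hBconv : Convex ℝ B := (convex_ball _ _).inter I.convex_range
  let Ψ : EM × (F →L[ℂ] ℂ) → Fin r → ℂ := fun p i =>
    -p.2 (e ⟨φ.symm p.1, (s i.castSucc).1 (φ.symm p.1)⟩).2
  have hsec : ∀ i : Fin r, ContDiffOn ℝ 1
      (fun y => (e ⟨φ.symm y, (s i.castSucc).1 (φ.symm y)⟩).2) B := fun i => by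
    have h1 := e.contMDiffOn_section_baseSet_iff.1
      (ContMDiff.contMDiffOn (s := e.baseSet) (s i.castSucc).2)
    have h2 := h1.comp ((contMDiffOn_extChartAt_symm (I := I) (n := ∞) x₀).mono
      (inter_subset_left.trans' hball)) fun y hy => (hball hy).2
    exact h2.contDiffOn.of_le (by exact_mod_cast le_top)
  have hΨ : ContDiffOn ℝ 1 Ψ (B ×ˢ univ) := by
    refine contDiffOn_pi.2 fun i => ContDiffOn.neg ?_
    have hev : ContDiff ℝ 1 fun p : (F →L[ℂ] ℂ) × F => p.1 p.2 :=
      (isBoundedBilinearMap_apply (𝕜 := ℝ) (E := F) (F := ℂ)).contDiff.comp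
        (((ContinuousLinearMap.restrictScalarsL ℂ F ℂ ℝ ℝ).contDiff.comp contDiff_fst).prodMk
          contDiff_snd)
    exact hev.comp_contDiffOn (contDiff_snd.contDiffOn.prodMk
      ((hsec i).comp contDiff_fst.contDiffOn fun p hp => hp.1))
  refine ⟨φ.source ∩ φ ⁻¹' Metric.ball (φ x₀) ε, ?_, ?_⟩
  · exact inter_mem (extChartAt_source_mem_nhds x₀)
      ((continuousAt_extChartAt x₀).preimage_mem_nhds (Metric.ball_mem_nhds _ hε))
  calc _ ≤ dimH (Ψ '' (B ×ˢ univ)) := dimH_mono ?_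
    _ ≤ dimH (B ×ˢ (univ : Set (F →L[ℂ] ℂ))) :=
        hΨ.dimH_image_le (hBconv.prod convex_univ) Subset.rfl
    _ ≤ dimH (univ : Set (EM × (F →L[ℂ] ℂ))) := dimH_mono (subset_univ _)
    _ = _ := Real.dimH_univ_eq_finrank _
  rintro a ⟨x, ⟨hxs, hxb⟩, hsp, hbad⟩
  obtain ⟨ℓ, hℓ⟩ := exists_functional_of_mem_badParameters hsp hbad
  have hxB : φ x ∈ B := ⟨hxb, by simp [φ, extChartAt]⟩
  have hxe : x ∈ e.baseSet := by
    have := (hball hxB).2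
    rwa [mem_preimage, φ.left_inv hxs] at this
  let L := e.continuousLinearEquivAt ℂ x hxe
  refine ⟨(φ x, (ℓ ∘ₗ (L.symm : F →ₗ[ℂ] E x)).toContinuousLinearMap), ⟨hxB, mem_univ _⟩, ?_⟩
  funext i
  rw [hℓ i]
  simp only [Ψ]
  rw [φ.left_inv hxs]
  congr 1
  change ℓ (L.symm (L ((s i.castSucc).1 x))) = _
  rw [L.symm_apply_apply]

/-- Countably many of the neighbourhoods cover M, so the set of all bad parameters still has
dimension below 2r, the real dimension of ℂʳ. Some parameter avoids it, and the last section becomes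
superfluous. -/
theorem exists_fewer_spanning {r : ℕ} (s : Fin (r + 1) → SmoothSections I F E) {K : Set M}
    (hs : ∀ x ∈ K, SpansAt s x) (hr : Module.finrank ℝ (EM × (F →L[ℂ] ℂ)) < r) :
    ∃ t : Fin r → SmoothSections I F E, ∀ x ∈ K, SpansAt t x := by
  choose V hV hVd using exists_nhds_dimH_badParameters_le s
  obtain ⟨C, hC, hCV⟩ := countable_cover_nhds_of_sigmaCompact hV
  have hdim : dimH (⋃ c ∈ C, {a | ∃ x ∈ V c, SpansAt s x ∧ a ∈ badParameters s x}) <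
      Module.finrank ℝ (Fin r → ℂ) := by
    rw [dimH_bUnion hC]
    refine (iSup₂_le fun c _ => hVd c).trans_lt ?_
    rw [Module.finrank_pi_fintype]
    simp only [Complex.finrank_real_complex, Finset.sum_const, Finset.card_univ, Fintype.card_fin,
      smul_eq_mul]
    exact_mod_cast (show _ < r * 2 by omega)
  obtain ⟨a, ha⟩ := (dense_compl_of_dimH_lt_finrank hdim).nonempty
  refine ⟨fun i => s i.castSucc + a i • s (Fin.last r), fun x hx => ?_⟩
  by_contra hbad
  obtain ⟨c, hc, hxc⟩ := mem_iUnion₂.1 (hCV.symm.subset (mem_univ x))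
  exact ha (mem_iUnion₂.2 ⟨c, hc, x, hxc, hs x hx, hbad⟩)

variable (I F E) in
/-- A bound, independent of the compact set, for the number of sections needed to span. -/
theorem exists_uniform_spanning : ∃ R : ℕ, ∀ K : Set M, IsCompact K →
    ∃ t : Fin R → SmoothSections I F E, ∀ x ∈ K, SpansAt t x := by
  set d := Module.finrank ℝ (EM × (F →L[ℂ] ℂ)) with hd
  refine ⟨d + 1, fun K hK => ?_⟩
  obtain ⟨n, s, hs⟩ := exists_spansAt_of_isCompact (I := I) (F := F) (E := E) hK
  induction n with
  | zero =>
    refine ⟨0, fun x hx => eq_top_iff.2 ((hs x hx).symm.le.trans (Submodule.span_mono ?_))⟩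
    rintro _ ⟨i, rfl⟩
    exact i.elim0
  | succ n ih =>
    -- While d < n one section can be removed; otherwise n + 1 ≤ d + 1 and the family is padded with
    -- zero sections.
    by_cases hn : d < n
    · obtain ⟨t, ht⟩ := exists_fewer_spanning s hs hn
      exact ih t ht
    · refine ⟨fun i => if h : i.1 < n + 1 then s ⟨i.1, h⟩ else 0, fun x hx =>
        eq_top_iff.2 ((hs x hx).symm.le.trans (Submodule.span_mono ?_))⟩
      rintro _ ⟨i, rfl⟩
      exact ⟨⟨i.1, by omega⟩, by simp [Nat.le_of_lt_succ i.2]⟩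

end Sections

section Frames

open Set Filter Topology Bundle

variable {EM : Type*} [NormedAddCommGroup EM] [NormedSpace ℝ EM] [FiniteDimensional ℝ EM]
  {HM : Type*} [TopologicalSpace HM] {I : ModelWithCorners ℝ EM HM}
  {M : Type*} [TopologicalSpace M] [ChartedSpace HM M] [IsManifold I ∞ M]
  [T2Space M] [SigmaCompactSpace M]
  {F : Type*} [NormedAddCommGroup F] [NormedSpace ℂ F] [FiniteDimensional ℂ F]
  {E : M → Type*} [∀ x, AddCommGroup (E x)] [∀ x, Module ℂ (E x)]
  [TopologicalSpace (Bundle.TotalSpace F E)] [∀ x, TopologicalSpace (E x)] [FiberBundle F E]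
  [VectorBundle ℂ F E] [VectorBundle ℝ F E] [ContMDiffVectorBundle ∞ F E I]

/-! ## Finitely many global sections span -/

variable (I M) in
/-- Cut-off functions for a sequence of layers such that layers at distance three are disjoint. -/
theorem exists_layer_functions : ∃ (K : CompactExhaustion M) (χ : ℕ → M → ℝ),
    (∀ n, ContMDiff I 𝓘(ℝ) ∞ (χ n)) ∧ (∀ n x, χ n x ≠ 0 → x ∈ K (n + 2) \ K (n - 1)) ∧
    ∀ x, ∃ n, x ∈ K (n + 1) ∧ χ n x = 1 := by
  have : LocallyCompactSpace M := Manifold.locallyCompact_of_finiteDimensional I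
  -- The shift makes `K 0` empty, so that the truncated index n − 1 = 0 removes nothing from the
  -- first layer.
  let K : CompactExhaustion M := (default : CompactExhaustion M).shiftr
  have hχ : ∀ n, ∃ f : M → ℝ, ContMDiff I 𝓘(ℝ) ∞ f ∧
      (∀ x, f x ≠ 0 → x ∈ K (n + 2) \ K (n - 1)) ∧
      ∀ x ∈ K (n + 1) \ interior (K n), f x = 1 := by
    intro n
    have hd : Disjoint (interior (K (n + 2)) \ K (n - 1))ᶜ (K (n + 1) \ interior (K n)) := by
      rw [Set.disjoint_left]
      rintro x hx ⟨h1, h2⟩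
      refine hx ⟨K.subset_interior_succ (n + 1) h1, fun h3 => h2 ?_⟩
      cases n with
      | zero => exact h3.elim
      | succ n => exact K.subset_interior_succ n h3
    obtain ⟨f, hf0, hf1, -⟩ := exists_contMDiffMap_zero_one_of_isClosed I (n := ⊤)
      (isOpen_interior.sdiff (K.isCompact (n - 1)).isClosed).isClosed_compl
      ((K.isCompact (n + 1)).isClosed.sdiff isOpen_interior) hd
    refine ⟨f, f.contMDiff, fun x hx => ?_, hf1⟩
    by_contra h
    exact hx (hf0 fun h' => h ⟨interior_subset h'.1, h'.2⟩)
  choose χ h1 h2 h3 using hχ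
  refine ⟨K, χ, h1, h2, fun x => ?_⟩
  obtain ⟨hx1, hx2⟩ := (default : CompactExhaustion M).mem_sdiff_shiftr_find x
  exact ⟨_, hx1, h3 _ x ⟨hx1, fun h => hx2 (interior_subset h)⟩⟩

-- R sections span over each layer, with R independent of the layer. Layers with the same index
-- modulo 3 have cut-offs of disjoint support, so their sections can be added without interference,
-- leaving 3R in all.
variable (I F E) in
theorem exists_spanning_sections :
    ∃ (N : ℕ) (t : Fin N → SmoothSections I F E), ∀ x, SpansAt t x := by
  obtain ⟨R, hR⟩ := exists_uniform_spanning I F E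
  obtain ⟨K, χ, hχ, hsupp, hcov⟩ := exists_layer_functions I M
  choose s hs using fun n => hR (K n) (K.isCompact n)
  have hlf : ∀ (c : Fin 3) (i : Fin R), LocallyFinite fun m : ℕ =>
      {x : M | χ (3 * m + c) x • (s (3 * m + c + 1) i).1 x ≠ 0} := by
    intro c i x
    obtain ⟨j, hj⟩ := K.exists_mem_nhds x
    refine ⟨K j, hj, (finite_le_nat j).subset ?_⟩
    rintro m ⟨y, hy, hyj⟩
    have h1 : χ (3 * m + c) y ≠ 0 := fun h => hy (by rw [h, zero_smul])
    by_contra hm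
    have hm' : ¬ m ≤ j := hm
    exact (hsupp _ _ h1).2 (K.subset (by omega) hyj)
  let t : Fin 3 × Fin R → SmoothSections I F E := fun p =>
    ⟨fun x => ∑ᶠ m : ℕ, χ (3 * m + p.1) x • (s (3 * m + p.1 + 1) p.2).1 x,
      ContMDiff.finsum_section_of_locallyFinite (hlf p.1 p.2) fun m =>
        ContMDiff.smul_section (hχ _) (s _ _).2⟩
  have ht : ∀ x, Submodule.span ℂ (range fun p => (t p).1 x) = ⊤ := by
    intro x
    obtain ⟨n, hxn, hn⟩ := hcov x
    refine eq_top_iff.2 ((hs (n + 1) x hxn).symm.le.trans (Submodule.span_mono ?_))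
    rintro _ ⟨i, rfl⟩
    refine ⟨(⟨n % 3, Nat.mod_lt _ (by norm_num)⟩, i), ?_⟩
    change ∑ᶠ m : ℕ, χ (3 * m + n % 3) x • (s (3 * m + n % 3 + 1) i).1 x = _
    rw [finsum_eq_single _ (n / 3), Nat.div_add_mod, hn, one_smul]
    intro m hm
    have hχn := hsupp n x (by rw [hn]; exact one_ne_zero)
    suffices h : χ (3 * m + n % 3) x = 0 by rw [h, zero_smul]
    by_contra h
    have hχm := hsupp _ _ h
    rcases lt_or_gt_of_ne hm with hlt | hlt
    · exact hχn.2 (K.subset (by omega) hχm.1)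
    · exact hχm.2 (K.subset (by omega) hχn.1)
  let e := Fintype.equivFin (Fin 3 × Fin R)
  refine ⟨_, fun i => t (e.symm i), fun x => ?_⟩
  have := ht x
  rwa [← e.symm.surjective.range_comp] at this

/-! ## Orthonormal frames -/

namespace HermitianMetric

variable (g : HermitianMetric I F E)

theorem inner_self_eq (x : M) (v : E x) : g.inner x v v = ((g.inner x v v).re : ℂ) := by
  have := g.conj_symm x v v
  exact (Complex.conj_eq_iff_re.1 this).symm

theorem eq_zero_of_inner_self {x : M} {v : E x} (h : g.inner x v v = 0) : v = 0 := by
  by_contra hv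
  have := g.pos x v hv
  rw [h] at this
  exact this.ne rfl

/-- Orthonormality of a family in a fibre. -/
def Orthonormal {ι : Type*} [DecidableEq ι] (x : M) (v : ι → E x) : Prop :=
  ∀ i j, g.inner x (v i) (v j) = if i = j then 1 else 0

theorem Orthonormal.linearIndependent {ι : Type*} [Fintype ι] [DecidableEq ι] {x : M} {v : ι → E x}
    (hv : g.Orthonormal x v) : LinearIndependent ℂ v := by
  refine Fintype.linearIndependent_iff.2 fun c hc i => ?_
  have : g.inner x (v i) (∑ j, c j • v j) = c i := by
    simp [map_sum, hv i]
  rw [← this, hc, map_zero]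

theorem Orthonormal.sum_eq {n : ℕ} {x : M} {v : Fin n → E x} (hv : g.Orthonormal x v)
    (hn : n = Module.finrank ℂ F) (w : E x) : ∑ i, g.inner x (v i) w • v i = w := by
  have hrank : Module.finrank ℂ (E x) = n := by
    rw [hn]
    exact ((trivializationAt F E x).linearEquivAt ℂ x
      (mem_baseSet_trivializationAt F E x)).finrank_eq
  have : Module.Finite ℂ (E x) := Module.Finite.equiv ((trivializationAt F E x).linearEquivAt ℂ x
      (mem_baseSet_trivializationAt F E x)).symm
  have hspan : Submodule.span ℂ (range v) = ⊤ :=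
    hv.linearIndependent.span_eq_top_of_card_eq_finrank' (by rw [Fintype.card_fin, hrank])
  have hw : w ∈ Submodule.span ℂ (range v) := hspan ▸ Submodule.mem_top
  obtain ⟨c, rfl⟩ := (Submodule.mem_span_range_iff_exists_fun ℂ).1 hw
  refine Finset.sum_congr rfl fun i _ => ?_
  congr 1
  simp [map_sum, hv i]

/-- The normalizing factor of a section. -/
noncomputable def normInv (w : ∀ x, E x) (x : M) : ℂ :=
  ((Real.sqrt (g.inner x (w x) (w x)).re)⁻¹ : ℝ)

theorem contMDiffOn_normInv {U : Set M} (hU : IsOpen U) {w : ∀ x, E x}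
    (hw : SmoothSectionOn I F w U) (hw0 : ∀ x ∈ U, w x ≠ 0) :
    ContMDiffOn I 𝓘(ℝ, ℂ) ∞ (g.normInv w) U := by
  intro x hx
  have hpos := g.pos x (w x) (hw0 x hx)
  have h1 : ContDiffAt ℝ ∞ (fun z : ℂ => (((Real.sqrt z.re)⁻¹ : ℝ) : ℂ))
      (g.inner x (w x) (w x)) := by
    refine Complex.ofRealCLM.contDiff.contDiffAt.comp _ ?_
    refine ContDiffAt.inv ?_ (Real.sqrt_pos.2 hpos).ne'
    exact (Real.contDiffAt_sqrt hpos.ne').comp _ Complex.reCLM.contDiff.contDiffAt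
  exact ContMDiffAt.comp_contMDiffWithinAt (g := fun z : ℂ => (((Real.sqrt z.re)⁻¹ : ℝ) : ℂ)) x
    h1.contMDiffAt (g.contMDiffOn hw hw hU x hx)

theorem inner_normInv (w : ∀ x, E x) {x : M} (hw : w x ≠ 0) :
    g.inner x (g.normInv w x • w x) (g.normInv w x • w x) = 1 := by
  have hpos := g.pos x (w x) hw
  simp only [map_smulₛₗ, LinearMap.smul_apply, smul_eq_mul, RingHom.id_apply]
  rw [g.inner_self_eq, normInv, Complex.conj_ofReal, ← Complex.ofReal_mul, ← Complex.ofReal_mul]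
  norm_cast
  have h := Real.mul_self_sqrt hpos.le
  have h' := (Real.sqrt_pos.2 hpos).ne'
  field_simp
  rw [sq, h]

/-- Gram–Schmidt with smooth coefficients. The span clause is carried through the induction to show
that the next vector is nonzero before normalization. -/
theorem exists_orthonormal_frame {n : ℕ} {U : Set M} (hU : IsOpen U) (s : Fin n → ∀ x, E x)
    (hs : ∀ i, SmoothSectionOn I F (s i) U) (hli : ∀ x ∈ U, LinearIndependent ℂ fun i => s i x) :
    ∃ e : Fin n → ∀ x, E x, (∀ i, SmoothSectionOn I F (e i) U) ∧
      (∀ x ∈ U, g.Orthonormal x fun i => e i x) ∧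
      ∀ x ∈ U, ∀ i, e i x ∈ Submodule.span ℂ (range fun i => s i x) := by
  induction n with
  | zero => exact ⟨Fin.elim0, fun i => i.elim0, fun _ _ i => i.elim0, fun _ _ i => i.elim0⟩
  | succ n ih =>
    obtain ⟨e, he1, he2, he3⟩ := ih (fun i => s i.castSucc) (fun i => hs _) fun x hx =>
      (hli x hx).comp _ (Fin.castSucc_injective n)
    set σ := s (Fin.last n)
    let p : ∀ x, E x := fun x => ∑ i, g.inner x (e i x) (σ x) • e i x
    let w : ∀ x, E x := σ - p
    have hp : SmoothSectionOn I F p U := ContMDiffOn.sum_section fun i _ =>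
      (he1 i).complex_smul (g.contMDiffOn (he1 i) (hs _) hU) hU
    have hw : SmoothSectionOn I F w U := ContMDiffOn.sub_section (hs _) hp
    have hpspan : ∀ x ∈ U, p x ∈ Submodule.span ℂ (range fun i : Fin n => s i.castSucc x) :=
      fun x hx => Submodule.sum_mem _ fun i _ => Submodule.smul_mem _ _ (he3 x hx i)
    have hsub : ∀ x, Submodule.span ℂ (range fun i : Fin n => s i.castSucc x) ≤
        Submodule.span ℂ (range fun i => s i x) := fun x => Submodule.span_mono (by
      rintro _ ⟨i, rfl⟩; exact ⟨_, rfl⟩)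
    have hw0 : ∀ x ∈ U, w x ≠ 0 := fun x hx h0 => by
      have h1 : σ x = p x := sub_eq_zero.1 h0
      have h2 := (linearIndependent_finSucc'.1 (hli x hx)).2
      refine h2 ?_
      change σ x ∈ _
      rw [h1]
      exact hpspan x hx
    have hew : ∀ x ∈ U, ∀ i, g.inner x (e i x) (w x) = 0 := fun x hx i => by
      change g.inner x (e i x) (σ x - ∑ j, g.inner x (e j x) (σ x) • e j x) = 0
      simp [map_sub, map_sum, he2 x hx i]
    have hwe : ∀ x ∈ U, ∀ i, g.inner x (w x) (e i x) = 0 := fun x hx i => by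
      rw [← g.conj_symm, hew x hx i, star_zero]
    refine ⟨Fin.snoc (α := fun _ => ∀ x, E x) e fun x => g.normInv w x • w x, ?_, ?_, ?_⟩
    · refine Fin.lastCases ?_ fun i => ?_
      · rw [Fin.snoc_last]
        exact hw.complex_smul (g.contMDiffOn_normInv hU hw hw0) hU
      · rw [Fin.snoc_castSucc]; exact he1 i
    · intro x hx
      refine Fin.lastCases ?_ fun i => ?_ <;> refine Fin.lastCases ?_ fun j => ?_
      · simp only [Fin.snoc_last, if_true]
        exact g.inner_normInv w (hw0 x hx)
      · simp [Fin.snoc_last, Fin.snoc_castSucc, hwe x hx j, (Fin.castSucc_lt_last j).ne']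
      · simp [Fin.snoc_last, Fin.snoc_castSucc, hew x hx i, (Fin.castSucc_lt_last i).ne]
      · simpa [Fin.snoc_castSucc] using he2 x hx i j
    · intro x hx
      refine Fin.lastCases ?_ fun i => ?_
      · rw [Fin.snoc_last]
        refine Submodule.smul_mem _ _ (Submodule.sub_mem _ ?_ (hsub x (hpspan x hx)))
        exact Submodule.subset_span ⟨_, rfl⟩
      · rw [Fin.snoc_castSucc]
        exact hsub x (he3 x hx i)

/-! ## Tight frames -/

/-- A null vector c of the Gram matrix makes Σ c_j t_j orthogonal to itself, hence zero. The
criterion makes independence an open condition. -/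
theorem linearIndependent_iff_det {n : ℕ} (t : Fin n → SmoothSections I F E) (x : M) :
    LinearIndependent ℂ (fun i => (t i).1 x) ↔
      (Matrix.of fun i j => g.inner x ((t i).1 x) ((t j).1 x)).det ≠ 0 := by
  have hmul : ∀ (c : Fin n → ℂ) i,
      ((Matrix.of fun i j => g.inner x ((t i).1 x) ((t j).1 x)).mulVec c) i =
        g.inner x ((t i).1 x) (∑ j, c j • (t j).1 x) := fun c i => by
    simp [Matrix.mulVec, dotProduct, map_sum, mul_comm]
  rw [← not_iff_not, not_not, ← Matrix.exists_mulVec_eq_zero_iff, Fintype.not_linearIndependent_iff]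
  constructor
  · rintro ⟨c, hc, i, hi⟩
    exact ⟨c, fun h => hi (congr_fun h i), funext fun j => by rw [hmul, hc, map_zero]; rfl⟩
  · rintro ⟨c, hc, h⟩
    obtain ⟨i, hi⟩ := Function.ne_iff.1 hc
    refine ⟨c, g.eq_zero_of_inner_self ?_, i, hi⟩
    have h1 : ∀ j, g.inner x ((t j).1 x) (∑ j, c j • (t j).1 x) = 0 := fun j => by
      rw [← hmul, h]; rfl
    have h2 : ∀ w, (∀ j, g.inner x ((t j).1 x) w = 0) →
        g.inner x (∑ j, c j • (t j).1 x) w = 0 := fun w hw => by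
      simp [map_sum, LinearMap.sum_apply, hw]
    exact h2 _ h1

theorem isOpen_linearIndependent (g : HermitianMetric I F E) {n : ℕ} (t : Fin n → SmoothSections I F E) :
    IsOpen {x | LinearIndependent ℂ fun i => (t i).1 x} := by
  simp only [g.linearIndependent_iff_det t]
  refine isOpen_ne_fun (Continuous.matrix_det ?_) continuous_const
  exact continuous_matrix fun i j => (g.smooth (t i) (t j)).continuous

theorem exists_linearIndependent_of_spansAt {N : ℕ} {t : Fin N → SmoothSections I F E} {x : M}
    (ht : SpansAt t x) :
    ∃ J : Fin (Module.finrank ℂ F) → Fin N, LinearIndependent ℂ fun i => (t (J i)).1 x := by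
  have hrank : Module.finrank ℂ (E x) = Module.finrank ℂ F :=
    ((trivializationAt F E x).linearEquivAt ℂ x
      (mem_baseSet_trivializationAt F E x)).finrank_eq
  obtain ⟨κ, a, ha, hspan, hli⟩ := exists_linearIndependent' ℂ fun i => (t i).1 x
  have : Fintype κ := Fintype.ofInjective a ha
  have hcard : Fintype.card κ = Module.finrank ℂ F := by
    rw [← hrank, Module.finrank_eq_card_basis (Module.Basis.mk hli (by rw [hspan]; exact ht.ge))]
  let σ := (Fintype.equivFinOfCardEq hcard).symm
  exact ⟨fun i => a (σ i), hli.comp _ σ.injective⟩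

/-- Functions whose squares form a partition of unity. -/
theorem _root_.exists_square_partition {ι : Type*} [Fintype ι] (W : ι → Set M)
    (hW : ∀ i, IsOpen (W i)) (hcov : ∀ x, ∃ i, x ∈ W i) :
    ∃ χ : ι → M → ℝ, (∀ i, ContMDiff I 𝓘(ℝ) ∞ (χ i)) ∧ (∀ i, tsupport (χ i) ⊆ W i) ∧
      ∀ x, ∑ i, χ i x ^ 2 = 1 := by
  obtain ⟨ρ, hρ⟩ := SmoothPartitionOfUnity.exists_isSubordinate I isClosed_univ W hW
    fun x _ => mem_iUnion.2 (hcov x)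
  have hpos : ∀ x, 0 < ∑ i, ρ i x ^ 2 := fun x => by
    obtain ⟨i, hi⟩ := ρ.exists_pos_of_mem (mem_univ x)
    exact Finset.sum_pos' (fun j _ => sq_nonneg _) ⟨i, Finset.mem_univ _, pow_pos hi 2⟩
  have hinv : ContMDiff I 𝓘(ℝ) ∞ fun x => (Real.sqrt (∑ i, ρ i x ^ 2))⁻¹ := fun x => by
    have h1 : ContDiffAt ℝ ∞ (fun y : ℝ => (Real.sqrt y)⁻¹) (∑ i, ρ i x ^ 2) :=
      (Real.contDiffAt_sqrt (hpos x).ne').inv (Real.sqrt_pos.2 (hpos x)).ne'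
    have h2 : ContMDiff I 𝓘(ℝ) ∞ fun x => ∑ i, ρ i x ^ 2 :=
      contMDiff_finsetSum fun i _ => (ρ i).contMDiff.pow 2
    exact ContMDiffAt.comp (g := fun y : ℝ => (Real.sqrt y)⁻¹) x h1.contMDiffAt h2.contMDiffAt
  refine ⟨fun i x => ρ i x * (Real.sqrt (∑ i, ρ i x ^ 2))⁻¹, fun i => (ρ i).contMDiff.mul hinv,
    fun i => (closure_mono (Function.support_mul_subset_left _ _)).trans (hρ i), fun x => ?_⟩
  simp only [mul_pow, ← Finset.sum_mul]
  rw [inv_pow, Real.sq_sqrt (hpos x).le, mul_inv_cancel₀ (hpos x).ne']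

/-- The orthonormal frame over W_J, weighted by χ_J, contributes χ_J² v to the expansion of v and
χ_J² k to the trace; the χ_J² sum to 1. The cover is finite because J runs over the choices of k
among N spanning sections. -/
theorem exists_tight_frame : ∃ (N : ℕ) (e : Fin N → SmoothSections I F E),
    (∀ x (v : E x), ∑ i, g.inner x ((e i).1 x) v • (e i).1 x = v) ∧
    ∀ x, ∑ i, g.inner x ((e i).1 x) ((e i).1 x) = Module.finrank ℂ F := by
  obtain ⟨N, t, ht⟩ := exists_spanning_sections I F E
  set k := Module.finrank ℂ F with hk
  let W : (Fin k → Fin N) → Set M := fun J => {x | LinearIndependent ℂ fun i => (t (J i)).1 x}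
  have hW : ∀ J, IsOpen (W J) := fun J => g.isOpen_linearIndependent fun i => t (J i)
  choose f hf1 hf2 hf3 using fun J => g.exists_orthonormal_frame (hW J)
    (fun i => (t (J i)).1) (fun i => ContMDiff.contMDiffOn (t (J i)).2) fun x hx => hx
  obtain ⟨χ, hχ1, hχ2, hχ3⟩ := exists_square_partition (I := I) W hW fun x =>
    exists_linearIndependent_of_spansAt (ht x)
  let e : (Fin k → Fin N) × Fin k → SmoothSections I F E := fun p =>
    ⟨χ p.1 • f p.1 p.2, ContMDiffOn.smul_section_of_tsupport (hχ1 p.1).contMDiffOn (hW p.1)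
      (hχ2 p.1) (hf1 p.1 p.2)⟩
  have he : ∀ p x, (e p).1 x = (χ p.1 x : ℂ) • f p.1 p.2 x := fun p x =>
    (Complex.coe_smul _ _).symm
  have hzero : ∀ J x, x ∉ W J → χ J x = 0 := fun J x hx =>
    image_eq_zero_of_notMem_tsupport fun h => hx (hχ2 J h)
  let σ := Fintype.equivFin ((Fin k → Fin N) × Fin k)
  refine ⟨_, fun i => e (σ.symm i), fun x v => ?_, fun x => ?_⟩
  · rw [σ.symm.sum_comp fun p => g.inner x ((e p).1 x) v • (e p).1 x, Fintype.sum_prod_type]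
    have h1 : ∀ J, ∑ i, g.inner x ((e (J, i)).1 x) v • (e (J, i)).1 x =
        ((χ J x ^ 2 : ℝ) : ℂ) • v := fun J => by
      by_cases hx : x ∈ W J
      · conv_rhs => rw [← (hf2 J x hx).sum_eq g hk v, Finset.smul_sum]
        refine Finset.sum_congr rfl fun i _ => ?_
        rw [he]
        simp only [map_smulₛₗ, LinearMap.smul_apply, smul_smul, smul_eq_mul, Complex.conj_ofReal]
        congr 1
        push_cast
        ring
      · simp [he, hzero J x hx]
    rw [Finset.sum_congr rfl fun J _ => h1 J, ← Finset.sum_smul, ← Complex.ofReal_sum, hχ3,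
      Complex.ofReal_one, one_smul]
  · rw [σ.symm.sum_comp fun p => g.inner x ((e p).1 x) ((e p).1 x), Fintype.sum_prod_type]
    have h1 : ∀ J, ∑ i, g.inner x ((e (J, i)).1 x) ((e (J, i)).1 x) =
        ((χ J x ^ 2 : ℝ) : ℂ) * k := fun J => by
      by_cases hx : x ∈ W J
      · have : ∀ i, g.inner x ((e (J, i)).1 x) ((e (J, i)).1 x) = ((χ J x ^ 2 : ℝ) : ℂ) :=
          fun i => by
            have h2 := hf2 J x hx i i
            rw [if_pos rfl] at h2
            rw [he]
            simp only [map_smulₛₗ, LinearMap.smul_apply, smul_eq_mul, Complex.conj_ofReal, h2,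
              RingHom.id_apply]
            push_cast
            ring
        rw [Finset.sum_congr rfl fun i _ => this i]
        simp [mul_comm]
      · simp [he, hzero J x hx]
    rw [Finset.sum_congr rfl fun J _ => h1 J, ← Finset.sum_mul, ← Complex.ofReal_sum, hχ3,
      Complex.ofReal_one, one_mul]

end HermitianMetric

end Frames

/-! ### From fibrewise identities to the module of sections -/

section SectionForm

variable {EM : Type*} [NormedAddCommGroup EM] [NormedSpace ℝ EM]
  {HM : Type*} [TopologicalSpace HM] {I : ModelWithCorners ℝ EM HM}
  {M : Type*} [TopologicalSpace M] [ChartedSpace HM M]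
  {F : Type*} [NormedAddCommGroup F] [NormedSpace ℂ F]
  {E : M → Type*} [∀ x, AddCommGroup (E x)] [∀ x, Module ℂ (E x)]
  [TopologicalSpace (Bundle.TotalSpace F E)] [∀ x, TopologicalSpace (E x)] [FiberBundle F E]
  [VectorBundle ℂ F E] (g : HermitianMetric I F E)

theorem HermitianMetric.isHermitianForm_sectionForm : IsHermitianForm g.sectionForm where
  star_eq s t := Subtype.ext <| funext fun x => g.conj_symm x _ _
  right s t a := Subtype.ext <| funext fun x => by
    change g.inner x (s.1 x) (a.1 x • t.1 x) = g.inner x (s.1 x) (t.1 x) * a.1 x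
    rw [map_smul, smul_eq_mul, mul_comm]
  definite s hs := Subtype.ext <| funext fun x => by
    by_contra hx
    have h1 := g.pos x (s.1 x) hx
    have h2 : g.inner x (s.1 x) (s.1 x) = 0 := congr_fun (congr_arg Subtype.val hs) x
    rw [h2] at h1
    exact h1.ne rfl

theorem HermitianMetric.isTightFrame_sectionForm {N : ℕ} {e : Fin N → SmoothSections I F E}
    (he : ∀ x (v : E x), ∑ i, g.inner x ((e i).1 x) v • (e i).1 x = v) :
    IsTightFrame g.sectionForm e := fun s => Subtype.ext <| funext fun x => by
  rw [AddSubmonoidClass.coe_finsetSum, Finset.sum_apply]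
  exact he x (s.1 x)

/-- The frame has constant trace k > 0, so dividing it by √k normalizes the trace to 1. -/
theorem HermitianMetric.exists_unit_sectionForm [FiniteDimensional ℂ F] [Nontrivial F] {N : ℕ}
    {e : Fin N → SmoothSections I F E}
    (he : ∀ x, ∑ i, g.inner x ((e i).1 x) ((e i).1 x) = Module.finrank ℂ F) :
    ∃ w : Fin N → SmoothSections I F E, ∑ i, g.sectionForm (w i) (w i) = 1 := by
  have hk : (0 : ℝ) < Module.finrank ℂ F := by exact_mod_cast Module.finrank_pos
  set c : ℝ := (Real.sqrt (Module.finrank ℂ F))⁻¹ with hc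
  have hc2 : (c : ℂ) * c * Module.finrank ℂ F = 1 := by
    norm_cast
    rw [hc, ← mul_inv, Real.mul_self_sqrt hk.le, inv_mul_cancel₀ hk.ne']
  refine ⟨fun i => (c : ℂ) • e i, Subtype.ext <| funext fun x => ?_⟩
  rw [AddSubmonoidClass.coe_finsetSum, Finset.sum_apply]
  change ∑ i, g.inner x ((c : ℂ) • (e i).1 x) ((c : ℂ) • (e i).1 x) = 1
  simp only [map_smulₛₗ, LinearMap.smul_apply, smul_eq_mul, Complex.conj_ofReal, RingHom.id_apply,
    ← mul_assoc]
  rw [← Finset.mul_sum, he, hc2]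

end SectionForm

/-! ### The main theorem -/

theorem mainTheorem3
    {EM : Type uEM} [NormedAddCommGroup EM] [NormedSpace ℝ EM] [FiniteDimensional ℝ EM]
    {HM : Type uHM} [TopologicalSpace HM] (I : ModelWithCorners ℝ EM HM)
    (M : Type uM) [TopologicalSpace M] [ChartedSpace HM M] [IsManifold I ∞ M]
    [BoundarylessManifold I M] [T2Space M] [SigmaCompactSpace M]
    (F : Type uF) [NormedAddCommGroup F] [NormedSpace ℂ F] [FiniteDimensional ℂ F] [Nontrivial F]
    (E : M → Type uE) [∀ x, AddCommGroup (E x)] [∀ x, Module ℂ (E x)]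
    [TopologicalSpace (Bundle.TotalSpace F E)] [∀ x, TopologicalSpace (E x)] [FiberBundle F E]
    [VectorBundle ℂ F E] [VectorBundle ℝ F E] [ContMDiffVectorBundle ∞ F E I]
    (g : HermitianMetric I F E)
    (P : PoissonStructure I M) (S : HermitianStarProduct P)
    (𝓔 : ModuleDeformation S.toHermitianDeformation (SmoothSections I F E)) :
    Nonempty (HermitianModuleDeformation 𝓔 g.sectionForm) ∧
    ∀ h : HermitianModuleDeformation 𝓔 g.sectionForm,
      ∃ (_ : StarRing (Module.End S.Algᵐᵒᵖ 𝓔.Mod))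
        (_ : StarModule ℂ⟦X⟧ (Module.End S.Algᵐᵒᵖ 𝓔.Mod)),
        (∀ (T : Module.End S.Algᵐᵒᵖ 𝓔.Mod) (x y : 𝓔.Mod),
          h.form x (T y) = h.form (star T x) y) ∧
        IsNondegenerateEquivalenceBimodule.{uM, max uM uE, max uM uE, uH} h.form h.theta ∧
        FormallyMoritaEquivalent.{uM, max uM uE, max uM uE, uH}
          S.Alg (Module.End S.Algᵐᵒᵖ 𝓔.Mod) := by
  obtain ⟨N, e, he, htr⟩ := g.exists_tight_frame
  have hframe := g.isTightFrame_sectionForm he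
  obtain ⟨w, hw⟩ := g.exists_unit_sectionForm htr
  refine ⟨exists_hermitianModuleDeformation 𝓔 g.isHermitianForm_sectionForm hframe, fun h => ?_⟩
  obtain ⟨s₁, s₂, hadj, hbim⟩ := h.exists_isNondegenerateEquivalenceBimodule hframe hw
  exact ⟨s₁, s₂, hadj, hbim,
    ⟨𝓔.Mod, inferInstance, inferInstance, inferInstance, inferInstance, h.form, h.theta,
      hbim.toIsEquivalenceBimodule⟩⟩
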